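/- \textbf{Setting.} Let $\varepsilon\in\{1,-1\}$. A sequence $f:\mathbb{Z}\to\mathbb{C}$ is rapidly decreasing if $\sup_n|n|^k|f_n|<\infty$ for all $k\ge 0$. Let $\mathcal{P}_\varepsilon$ be the set of rapidly decreasing sequences $Q=(Q_n)$ with $1+\varepsilon|Q_n|^2\neq0$ for all $n$. Let $(E^jf)_n=f_{n+j}$, and let $(E-1)^{-1}$ be an inverse of $E-1$, $$\big((E-1)^{-1}f\big)_n=(1-c)\sum_{k<n}f_k-c\sum_{k\ge n}f_k ,$$ where the constant of summation $c\in\mathbb{R}$ is arbitrary but fixed. For $u_n=(Q_n,R_n)^T$ and $\gamma_n^2=1-Q_nR_n$ let $$L=\begin{pmatrix}E&0\\0&E^{-1}\end{pmatrix}+\begin{pmatrix}-Q_nE\\R_n\end{pmatrix}(E-1)^{-1}(R_nE,\;Q_nE^{-1})+\gamma_n^2\begin{pmatrix}-EQ_n\\R_{n-1}\end{pmatrix}(E-1)^{-1}(R_n,\;Q_n)\frac1{\gamma_n^2},$$ $$L^{-1}=\begin{pmatrix}E^{-1}&0\\0&E\end{pmatrix}+\begin{pmatrix}Q_n\\-R_nE\end{pmatrix}(E-1)^{-1}(R_nE^{-1},\;Q_nE)+\gamma_n^2\begin{pmatrix}Q_{n-1}\\-ER_n\end{pmatrix}(E-1)^{-1}(R_n,\;Q_n)\frac1{\gamma_n^2},$$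 $\mathcal{L}=L-2I+L^{-1}$, $K^{(0)}_{[0]}=(Q_n,-R_n)^T$, $\sigma^{(0)}_{[0]}=(n+\tfrac12)(Q_n,-R_n)^T$, $K^{(0)}_{[1]}=\tfrac12(L-L^{-1})K^{(0)}_{[0]}$ and $\sigma^{(0)}_{[1]}=\tfrac12(L-L^{-1})\sigma^{(0)}_{[0]}$. For $j\in\{0,1\}$ and $m\ge0$ let $\widetilde K^{(m)}_{[j],1}$ and $\widetilde\sigma^{(m)}_{[j],1}$ be the first components of $\mathcal{L}^mK^{(0)}_{[j]}$ and $\mathcal{L}^m\sigma^{(0)}_{[j]}$ after the substitution $R_n=-\varepsilon Q_n^*$ ($*$ is complex conjugation); they are sequence-valued functions of $Q\in\mathcal{P}_\varepsilon$. The \emph{scalar isospectral and non-isospectral IDNLS flows} are $i^{j-1}\widetilde K^{(m)}_{[j],1}$ and $i^{j-1}\widetilde\sigma^{(m)}_{[j],1}$. With $Q_n$ as the only independent variable, put $f(Q)'[g]=\frac{d}{d\epsilon}\big|_{\epsilon=0}f(Q+\epsilon g)$ (with $\epsilon\in\mathbb{R}$, derivative taken for each $n$) and $$[\![f,g]\!]_{Q_n}=f'[g]-g'[f].$$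 \textbf{Theorem.} Let $V$ be the real vector space spanned by all the scalar flows $i^{j-1}\widetilde K^{(m)}_{[j],1}$ and $i^{j-1}\widetilde\sigma^{(s)}_{[j],1}$ with $j\in\{0,1\}$, $m,s\ge0$. Every $f\in V$ takes rapidly decreasing values and is Gateaux differentiable at each $Q\in\mathcal{P}_\varepsilon$ in each rapidly decreasing direction. $V$ is closed under $[\![\cdot,\cdot]\!]_{Q_n}$ and is a real Lie algebra with this product, and for all $j,k\in\{0,1\}$ and $m,s\ge0$: \begin{align*} [\![ i^{j-1}\widetilde{K}^{(m)}_{[j],1},\, i^{k-1}\widetilde{K}^{(s)}_{[k],1} ]\!]_{Q_n} &=0,\\ [\![ -i\widetilde{K}^{(m)}_{[0],1},\, -i\widetilde{\sigma}^{(s)}_{[0],1} ]\!]_{Q_n} &=-2m\, \widetilde{K}^{(m+s-1)}_{[1],1}, \\ [\![ -i\widetilde{K}^{(m)}_{[0],1},\, \widetilde{\sigma}^{(s)}_{[1],1} ]\!]_{Q_n} &=-\tfrac{1}{2}im \big(\widetilde{K}^{(m+s+1)}_{[0],1}+4\widetilde{K}^{(m+s)}_{[0],1}\big), \\ [\![ \widetilde{K}^{(m)}_{[1],1},\,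 i^{j-1}\widetilde{\sigma}^{(s)}_{[j],1} ]\!]_{Q_n} &=\tfrac{1}{2}i^{j-1}\big[(m+1) \widetilde{K}^{(m+s+1)}_{[j],1}+2(2m+1)\widetilde{K}^{(m+s)}_{[j],1}\big], \\ [\![ -i\widetilde{\sigma}^{(m)}_{[0],1},\, -i\widetilde{\sigma}^{(s)}_{[0],1} ]\!]_{Q_n} &=-2(m-s)\,\widetilde{\sigma}^{(m+s-1)}_{[1],1}, \\ [\![ i^{j-1}\widetilde{\sigma}^{(m)}_{[j],1},\, \widetilde{\sigma}^{(s)}_{[1],1} ]\!]_{Q_n} &=\tfrac{1}{2}i^{j-1}\big[(m-s-1+j)\widetilde{\sigma}^{(m+s+1)}_{[j],1}+2(2m-2s-1+j)\widetilde{\sigma}^{(m+s)}_{[j],1}\big], \end{align*} where $\widetilde{K}^{(-1)}_{[1],1}=\widetilde{\sigma}^{(-1)}_{[1],1}=0$ on the right-hand sides. -/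

import Mathlib

noncomputable section

namespace IDNLS

/-- Doubly infinite complex sequences `n ↦ f n`. -/
abbrev Sequence : Type := ℤ → ℂ

/-- Two-component sequences, written as column vectors `(f₁, f₂)ᵀ` on paper. -/
abbrev VecSequence : Type := Sequence × Sequence

/-- `f n → 0` as `|n| → ∞`, faster than any power of `|n|`. -/
def RapidlyDecreasing (f : Sequence) : Prop :=
  ∀ k : ℕ, ∃ C : ℝ, ∀ n : ℤ, |(n : ℝ)| ^ k * ‖f n‖ ≤ C

/-- The shift operator, `(E^j f)(n) = f (n + j)`. -/
def shift (j : ℤ) (f : Sequence) : Sequence := fun n => f (n + j)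

/-- The inverse of the difference operator `E - 1`:
`((E-1)⁻¹ f)(n) = (1-c) ∑_{k<n} f k - c ∑_{k≥n} f k`.
The real number `c` fixes the constant of summation: `c = 0` sums from `-∞`, `c = 1` sums from `+∞`,
and `c = 1/2` is the symmetric choice. -/
def invDiff (c : ℝ) (f : Sequence) : Sequence := fun n =>
  (1 - (c : ℂ)) * ∑' k : ℕ, f (n - 1 - (k : ℤ)) - (c : ℂ) * ∑' k : ℕ, f (n + (k : ℤ))

/-- The recursion operator `L` of the Ablowitz-Ladik hierarchy at the potential `u = (Q, R)`,
where `1 - Q * R` is `γ²`. -/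
def recursionL (c : ℝ) (u v : VecSequence) : VecSequence :=
  let Q := u.1
  let R := u.2
  let a := invDiff c (R * shift 1 v.1 + Q * shift (-1) v.2)
  let b := invDiff c ((R * v.1 + Q * v.2) / (1 - Q * R))
  (shift 1 v.1 - Q * shift 1 a - (1 - Q * R) * shift 1 (Q * b),
    shift (-1) v.2 + R * a + (1 - Q * R) * (shift (-1) R * b))

/-- The inverse `L⁻¹` of the recursion operator, given by its explicit formula. -/
def recursionLInv (c : ℝ) (u v : VecSequence) : VecSequence :=
  let Q := u.1
  let R := u.2
  let a := invDiff c (R * shift (-1) v.1 + Q * shift 1 v.2)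
  let b := invDiff c ((R * v.1 + Q * v.2) / (1 - Q * R))
  (shift (-1) v.1 + Q * a + (1 - Q * R) * (shift (-1) Q * b),
    shift 1 v.2 - R * shift 1 a - (1 - Q * R) * shift 1 (R * b))

/-- The operator `𝓛 = L - 2 I + L⁻¹`. -/
def recursionAKNS (c : ℝ) (u v : VecSequence) : VecSequence :=
  recursionL c u v - (2 : ℂ) • v + recursionLInv c u v

/-- `K^{(0)}_{[0]} = K^{(0)} = (Q, -R)ᵀ` and `K^{(0)}_{[1]} = (1/2) (L - L⁻¹) K^{(0)}`. -/
def isoSeed (c : ℝ) (j : Fin 2) (u : VecSequence) : VecSequence :=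
  let K : VecSequence := (u.1, -u.2)
  if j = 0 then K
  else (1 / 2 : ℂ) • (recursionL c u K - recursionLInv c u K)

/-- `σ^{(0)}_{[0]} = (1/2) σ^{(0)}` and `σ^{(0)}_{[1]} = (1/4) (L - L⁻¹) σ^{(0)}`, where
`σ^{(0)} = (2n+1) (Q, -R)ᵀ`. -/
def nonisoSeed (c : ℝ) (j : Fin 2) (u : VecSequence) : VecSequence :=
  let s : VecSequence := (fun n => (2 * (n : ℂ) + 1) * u.1 n, fun n => -((2 * (n : ℂ) + 1) * u.2 n))
  if j = 0 then (1 / 2 : ℂ) • s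
  else (1 / 4 : ℂ) • (recursionL c u s - recursionLInv c u s)

/-- The reduced potential: `(Q, R)` with `R = -ε Q^*`. -/
def reduced (ε : ℝ) (Q : Sequence) : VecSequence :=
  (Q, fun n => -(ε : ℂ) * (starRingEnd ℂ) (Q n))

/-- The potentials `Q` under consideration: rapidly decreasing, and such that
`γ² = 1 + ε |Q|²`, by which the recursion operator divides, has no zero. -/
def phaseSpace (ε : ℝ) : Set Sequence :=
  {Q | RapidlyDecreasing Q ∧ ∀ n, 1 + ε * ‖Q n‖ ^ 2 ≠ 0}

/-- Scalar flows, that is, sequence-valued functions of the potential `Q`. -/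
abbrev ScalarFlow (ε : ℝ) : Type := phaseSpace ε → Sequence

/-- `\widetilde K^{(m)}_{[j],1}`: the first component of `𝓛^m K^{(0)}_{[j]}` at `R = -ε Q^*`. -/
def isoFlow (c ε : ℝ) (j : Fin 2) (m : ℕ) : ScalarFlow ε := fun Q =>
  ((recursionAKNS c (reduced ε Q))^[m] (isoSeed c j (reduced ε Q))).1

/-- `\widetilde σ^{(s)}_{[j],1}`: the first component of `𝓛^s σ^{(0)}_{[j]}` at `R = -ε Q^*`. -/
def nonisoFlow (c ε : ℝ) (j : Fin 2) (s : ℕ) : ScalarFlow ε := fun Q =>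
  ((recursionAKNS c (reduced ε Q))^[s] (nonisoSeed c j (reduced ε Q))).1

/-- `pred F l` is `F^{(l-1)}`, with the convention `F^{(-1)} = 0`. -/
def pred {ε : ℝ} (F : ℕ → ScalarFlow ε) : ℕ → ScalarFlow ε
  | 0 => 0
  | l + 1 => F l

open Classical in
/-- The function `t ↦ f(Q + t g)(n)` of a real variable `t`. For rapidly decreasing `g` the sequence
`Q + t g` stays in the phase space for all small `t`, so the value `0` given to
the other `t` has no effect on derivatives at `t = 0`. -/
def alongLine {ε : ℝ} (f : ScalarFlow ε) (Q : phaseSpace ε) (g : Sequence) (n : ℤ) (t : ℝ) : ℂ :=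
  if h : (Q : Sequence) + t • g ∈ phaseSpace ε then f ⟨(Q : Sequence) + t • g, h⟩ n else 0

/-- The Gateaux derivative `f(Q)'[g] = d/dt f(Q + t g)` at `t = 0`, `t` real, with `Q` as the only
independent variable. -/
def gateaux {ε : ℝ} (f : ScalarFlow ε) (Q : phaseSpace ε) (g : Sequence) : Sequence :=
  fun n => deriv (alongLine f Q g n) 0

/-- The Lie product `⟦f, g⟧_Q = f'[g] - g'[f]`. -/
def lieProduct {ε : ℝ} (f g : ScalarFlow ε) : ScalarFlow ε :=
  fun Q => gateaux f Q (g Q) - gateaux g Q (f Q)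

/-- The factor `i^{j-1}`. -/
def phase (j : Fin 2) : ℂ := Complex.I ^ (((j : ℕ) : ℤ) - 1)

/-- The real vector space spanned by all flows `i^{j-1} \widetilde K^{(m)}_{[j],1}` and
`i^{j-1} \widetilde σ^{(s)}_{[j],1}`. -/
def flowSpan (c ε : ℝ) : Submodule ℝ (ScalarFlow ε) :=
  Submodule.span ℝ
    ({f | ∃ (j : Fin 2) (m : ℕ), f = phase j • isoFlow c ε j m} ∪
      {f | ∃ (j : Fin 2) (s : ℕ), f = phase j • nonisoFlow c ε j s})

end IDNLS

end

/-! Treat `Q` and `R` first as independent. On pairs of rapidly decreasing sequences `L` is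
invertible and, as a function of the potential, hereditary: its Nijenhuis torsion vanishes
(`recursionL_hereditary`). The fields K = (Q, -R) and σ = (n+1/2)(Q, -R) are commuting infinitesimal
phase rotations, and the rotation with phase κn + a rescales `L` infinitesimally by the factor κ
(`dRecL_twist`), which is 0 for K and 1 for σ. Formally this forces [L^a K, L^b K] = 0, [L^a K, L^b
σ] = a L^(a+b) K and [L^a σ, L^b σ] = (a-b) L^(a+b) σ for all integers a, b
(`jetBracket_zpow_zpow`).

So (p, q) ↦ p(L)K + q(L)σ carries a bracket on pairs of Laurent polynomials, built from the Euler
derivation T d/dT, to the bracket of vector fields (`jetBracket_fieldJet`). The flows come from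
powers of T - 2 + T⁻¹, times 1 or (T - T⁻¹)/2. The structure relations, the closure of the span and
the Jacobi identity thereby become short computations with Laurent polynomials.

Heredity rests on the zero curvature form of `L`. With U = ((z, Q), (R, 1/z)) there is, for each f,
a matrix M with (EM)U - UM off-diagonal and equal to z⁻¹ Lf - z f. The curvature of M along two such
directions solves homogeneous difference equations, and `balanced_eq_zero` makes it vanish for any
constant of summation, because every integration uses the same (E-1)⁻¹.

The scalar bracket is recovered by a real form. On R = -εQ* an antilinear involution exchanges L and
L⁻¹, and the factors i^(j-1) are exactly what makes the flows fixed by it, hence tangent to the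
reduced potentials (`isTangent_of_mem`). For tangent fields the Gateaux derivative in `Q` alone is
the derivative of the full system (`lieProduct_scalarFlow`). Differentiability under the infinite
sums comes from complexifying the line parameter: uniformly dominated series of holomorphic
functions are differentiated termwise. -/

namespace IDNLS

/-! ### Uniformly rapidly decreasing families -/

/-- The family `F` is rapidly decreasing, uniformly in the parameter `t ∈ s`. -/
def RapidOn {ι : Type*} (s : Set ι) (F : ι → Sequence) : Prop :=
  ∀ k : ℕ, ∃ C : ℝ, ∀ t ∈ s, ∀ n : ℤ, |(n : ℝ)| ^ k * ‖F t n‖ ≤ C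

/-- The family `F` is bounded, uniformly in the parameter `t ∈ s`. -/
def BoundedOn {ι : Type*} (s : Set ι) (F : ι → Sequence) : Prop :=
  ∃ C : ℝ, 0 ≤ C ∧ ∀ t ∈ s, ∀ n : ℤ, ‖F t n‖ ≤ C

section families

variable {ι : Type*} {s s' : Set ι} {F G : ι → Sequence}

theorem RapidlyDecreasing.rapidOn {f : Sequence} (hf : RapidlyDecreasing f) :
    RapidOn s (fun _ => f) := fun k => (hf k).imp fun _ hC _ _ n => hC n

theorem RapidOn.apply (hF : RapidOn s F) {t : ι} (ht : t ∈ s) : RapidlyDecreasing (F t) :=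
  fun k => (hF k).imp fun _ hC n => hC t ht n

theorem RapidOn.exists_nonneg (hF : RapidOn s F) (k : ℕ) :
    ∃ C : ℝ, 0 ≤ C ∧ ∀ t ∈ s, ∀ n : ℤ, |(n : ℝ)| ^ k * ‖F t n‖ ≤ C := by
  obtain ⟨C, hC⟩ := hF k
  exact ⟨max C 0, le_max_right _ _, fun t ht n => (hC t ht n).trans (le_max_left _ _)⟩

theorem RapidOn.mono (hF : RapidOn s F) (h : s' ⊆ s) : RapidOn s' F :=
  fun k => (hF k).imp fun _ hC t ht n => hC t (h ht) n

theorem RapidOn.congr (hF : RapidOn s F) (h : ∀ t ∈ s, F t = G t) : RapidOn s G :=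
  fun k => (hF k).imp fun _ hC t ht n => by simpa [← h t ht] using hC t ht n

theorem RapidOn.boundedOn (hF : RapidOn s F) : BoundedOn s F := by
  obtain ⟨C, h0, hC⟩ := hF.exists_nonneg 0
  exact ⟨C, h0, fun t ht n => by simpa using hC t ht n⟩

theorem RapidOn.mul_boundedOn (hF : RapidOn s F) (hG : BoundedOn s G) :
    RapidOn s (fun t => F t * G t) := fun k => by
  obtain ⟨C, h0, hC⟩ := hF.exists_nonneg k
  obtain ⟨D, -, hD⟩ := hG
  refine ⟨C * D, fun t ht n => ?_⟩
  change |(n : ℝ)| ^ k * ‖F t n * G t n‖ ≤ C * D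
  rw [norm_mul, ← mul_assoc]
  exact mul_le_mul (hC t ht n) (hD t ht n) (norm_nonneg _) h0

theorem RapidOn.add (hF : RapidOn s F) (hG : RapidOn s G) : RapidOn s (fun t => F t + G t) :=
  fun k => by
    obtain ⟨C, hC⟩ := hF k
    obtain ⟨D, hD⟩ := hG k
    refine ⟨C + D, fun t ht n => ?_⟩
    calc |(n : ℝ)| ^ k * ‖F t n + G t n‖ ≤ |(n : ℝ)| ^ k * (‖F t n‖ + ‖G t n‖) := by
          gcongr; exact norm_add_le _ _
      _ ≤ C + D := by rw [mul_add]; exact add_le_add (hC t ht n) (hD t ht n)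

theorem RapidOn.smul (a : ℂ) (hF : RapidOn s F) : RapidOn s (fun t => a • F t) := by
  have h : BoundedOn s (fun _ : ι => (fun _ => a : Sequence)) :=
    ⟨‖a‖, norm_nonneg _, fun _ _ _ => le_rfl⟩
  refine (hF.mul_boundedOn h).congr fun t _ => ?_
  funext n
  simp [mul_comm]

theorem RapidOn.index_mul (hF : RapidOn s F) :
    RapidOn s (fun t n => (n : ℂ) * F t n) := fun k => by
  obtain ⟨C, hC⟩ := hF (k + 1)
  refine ⟨C, fun t ht n => ?_⟩
  have h := hC t ht n
  rw [norm_mul, Complex.norm_intCast, ← mul_assoc, ← pow_succ]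
  exact h

theorem RapidOn.shift (j : ℤ) (hF : RapidOn s F) : RapidOn s (fun t => shift j (F t)) :=
  fun k => by
    obtain ⟨C, hC⟩ := hF k
    obtain ⟨D, hD⟩ := hF 0
    -- The power of 2 is the constant of `add_pow_le`; for `k = 0` the truncated exponent is 0,
    -- which still suffices.
    refine ⟨2 ^ (k - 1) * (C + |(j : ℝ)| ^ k * D), fun t ht n => ?_⟩
    have h1 : |(n : ℝ)| ^ k ≤ 2 ^ (k - 1) * (|((n + j : ℤ) : ℝ)| ^ k + |(j : ℝ)| ^ k) := by
      refine le_trans ?_ (add_pow_le (abs_nonneg _) (abs_nonneg _) k)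
      gcongr
      have h := abs_sub ((n + j : ℤ) : ℝ) (j : ℝ)
      push_cast at h ⊢
      simpa using h
    have h2 := hC t ht (n + j)
    have h3 := hD t ht (n + j)
    simp only [pow_zero, one_mul] at h3
    calc |(n : ℝ)| ^ k * ‖F t (n + j)‖
        ≤ 2 ^ (k - 1) * (|((n + j : ℤ) : ℝ)| ^ k + |(j : ℝ)| ^ k) * ‖F t (n + j)‖ := by gcongr
      _ = 2 ^ (k - 1) * (|((n + j : ℤ) : ℝ)| ^ k * ‖F t (n + j)‖
            + |(j : ℝ)| ^ k * ‖F t (n + j)‖) := by ring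
      _ ≤ _ := by gcongr

theorem BoundedOn.mono (hF : BoundedOn s F) (h : s' ⊆ s) : BoundedOn s' F := by
  obtain ⟨C, h0, hC⟩ := hF
  exact ⟨C, h0, fun t ht => hC t (h ht)⟩

theorem BoundedOn.shift (j : ℤ) (hF : BoundedOn s F) :
    BoundedOn s (fun t => IDNLS.shift j (F t)) := by
  obtain ⟨C, h0, hC⟩ := hF
  exact ⟨C, h0, fun t ht n => hC t ht (n + j)⟩

/-- A summable weight on `ℤ` dominating rapidly decreasing sequences. -/
noncomputable def weight (n : ℤ) : ℝ := (1 + (n : ℝ) ^ 2)⁻¹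

theorem weight_nonneg (n : ℤ) : 0 ≤ weight n := by unfold weight; positivity

theorem summable_weight : Summable weight := by
  have h : Summable fun n : ℤ => 1 / (n : ℝ) ^ 2 :=
    Real.summable_one_div_int_pow.mpr one_lt_two
  refine Summable.of_norm_bounded_eventually h ?_
  refine (Set.finite_singleton (0 : ℤ)).subset fun n hn => ?_
  by_contra h0
  refine hn ?_
  have : (n : ℝ) ≠ 0 := by exact_mod_cast h0
  have h2 : 0 < (n : ℝ) ^ 2 := by positivity
  change ‖weight n‖ ≤ 1 / (n : ℝ) ^ 2
  rw [Real.norm_of_nonneg (weight_nonneg n), weight, inv_eq_one_div]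
  exact one_div_le_one_div_of_le h2 (by linarith)

/-- The bounds for the exponents 0 and 2 add up to a bound on (1 + n²)‖F t n‖. A summable majorant
independent of `t` is all that summation and termwise differentiation need. -/
theorem RapidOn.le_weight (hF : RapidOn s F) :
    ∃ C : ℝ, 0 ≤ C ∧ ∀ t ∈ s, ∀ n : ℤ, ‖F t n‖ ≤ C * weight n := by
  obtain ⟨C, h0, hC⟩ := hF.exists_nonneg 0
  obtain ⟨D, h1, hD⟩ := hF.exists_nonneg 2
  refine ⟨C + D, by positivity, fun t ht n => ?_⟩
  have h2 := hC t ht n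
  have h3 := hD t ht n
  rw [weight, ← div_eq_mul_inv, le_div_iff₀ (by positivity)]
  simp only [pow_zero, one_mul, sq_abs] at h2 h3
  linarith

theorem injective_left (n : ℤ) : Function.Injective fun k : ℕ => n - 1 - (k : ℤ) :=
  fun a b h => by simpa using h

theorem injective_right (n : ℤ) : Function.Injective fun k : ℕ => n + (k : ℤ) :=
  fun a b h => by simpa using h

end families

theorem RapidlyDecreasing.summable_comp {f : Sequence} (hf : RapidlyDecreasing f) {e : ℕ → ℤ}
    (he : Function.Injective e) : Summable fun k => f (e k) := by
  obtain ⟨C, -, hC⟩ := (hf.rapidOn (s := Set.univ (α := Unit))).le_weight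
  exact Summable.of_norm_bounded ((summable_weight.comp_injective he).mul_left C)
    fun k => hC () trivial (e k)

theorem RapidOn.norm_tsum_le {ι : Type*} {s : Set ι} {F : ι → Sequence} {C : ℝ} (h0 : 0 ≤ C)
    (hC : ∀ t ∈ s, ∀ n : ℤ, ‖F t n‖ ≤ C * weight n) {e : ℕ → ℤ} (he : Function.Injective e)
    {t : ι} (ht : t ∈ s) : ‖∑' k, F t (e k)‖ ≤ C * ∑' n, weight n := by
  have h1 := (summable_weight.comp_injective he).mul_left C
  calc ‖∑' k, F t (e k)‖ ≤ ∑' k, C * weight (e k) :=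
        tsum_of_norm_bounded h1.hasSum fun k => hC t ht (e k)
    _ = C * ∑' k, weight (e k) := tsum_mul_left
    _ ≤ C * ∑' n, weight n := by
        gcongr
        exact tsum_comp_le_tsum_of_inj summable_weight weight_nonneg he

theorem RapidOn.invDiff {ι : Type*} {s : Set ι} {F : ι → Sequence} (c : ℝ) (hF : RapidOn s F) :
    BoundedOn s (fun t => invDiff c (F t)) := by
  obtain ⟨C, h0, hC⟩ := hF.le_weight
  have hw : 0 ≤ ∑' n, weight n := tsum_nonneg weight_nonneg
  refine ⟨‖(1 - (c : ℂ))‖ * (C * ∑' n, weight n) + ‖(c : ℂ)‖ * (C * ∑' n, weight n),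
    by positivity, fun t ht n => ?_⟩
  refine (norm_sub_le _ _).trans ?_
  rw [norm_mul, norm_mul]
  gcongr
  · exact RapidOn.norm_tsum_le h0 hC (injective_left n) ht
  · exact RapidOn.norm_tsum_le h0 hC (injective_right n) ht

/-! ### Rapidly decreasing sequences -/

/-- The space of rapidly decreasing sequences. -/
def rapid : Submodule ℂ Sequence where
  carrier := {f | RapidlyDecreasing f}
  add_mem' {f g} hf hg :=
    ((RapidlyDecreasing.rapidOn (s := Set.univ (α := Unit)) hf).add
      (RapidlyDecreasing.rapidOn hg)).apply (t := ()) trivial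
  zero_mem' k := ⟨0, fun n => by simp⟩
  smul_mem' a f hf :=
    ((RapidlyDecreasing.rapidOn (s := Set.univ (α := Unit)) hf).smul a).apply (t := ()) trivial

theorem rapid_mul {f g : Sequence} (hf : f ∈ rapid) {C : ℝ} (hg : ∀ n, ‖g n‖ ≤ C) :
    f * g ∈ rapid :=
  ((RapidlyDecreasing.rapidOn (s := Set.univ (α := Unit)) hf).mul_boundedOn
    (G := fun _ => g) ⟨max C 0, le_max_right _ _, fun _ _ n => (hg n).trans (le_max_left _ _)⟩).apply
      (t := ()) trivial

theorem rapid_bdd {f : Sequence} (hf : f ∈ rapid) : ∃ C, ∀ n, ‖f n‖ ≤ C := by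
  obtain ⟨C, -, hC⟩ := (RapidlyDecreasing.rapidOn (s := Set.univ (α := Unit)) hf).boundedOn
  exact ⟨C, hC () trivial⟩

theorem rapid_mul_rapid {f g : Sequence} (hf : f ∈ rapid) (hg : g ∈ rapid) : f * g ∈ rapid :=
  rapid_mul hf (rapid_bdd hg).choose_spec

theorem shift_rapid (j : ℤ) {f : Sequence} (hf : f ∈ rapid) : shift j f ∈ rapid :=
  ((RapidlyDecreasing.rapidOn (s := Set.univ (α := Unit)) hf).shift j).apply (t := ()) trivial

theorem invDiff_bdd (c : ℝ) {f : Sequence} (hf : f ∈ rapid) : ∃ C, ∀ n, ‖invDiff c f n‖ ≤ C := by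
  obtain ⟨C, -, hC⟩ := (RapidlyDecreasing.rapidOn (s := Set.univ (α := Unit)) hf).invDiff c
  exact ⟨C, hC () trivial⟩

theorem index_mul_rapid {f : Sequence} (hf : f ∈ rapid) :
    (fun n : ℤ => (n : ℂ) * f n : Sequence) ∈ rapid :=
  ((RapidlyDecreasing.rapidOn (s := Set.univ (α := Unit)) hf).index_mul).apply (t := ()) trivial

theorem invDiff_add (c : ℝ) {f g : Sequence} (hf : f ∈ rapid) (hg : g ∈ rapid) :
    invDiff c (f + g) = invDiff c f + invDiff c g := by
  funext n
  simp only [invDiff, Pi.add_apply]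
  rw [(RapidlyDecreasing.summable_comp hf (injective_left n)).tsum_add
      (RapidlyDecreasing.summable_comp hg (injective_left n)),
    (RapidlyDecreasing.summable_comp hf (injective_right n)).tsum_add
      (RapidlyDecreasing.summable_comp hg (injective_right n))]
  ring

theorem invDiff_smul (c : ℝ) (a : ℂ) (f : Sequence) :
    invDiff c (a • f) = a • invDiff c f := by
  funext n
  simp only [invDiff, Pi.smul_apply, smul_eq_mul, tsum_mul_left]
  ring

theorem invDiff_shift (c : ℝ) (j : ℤ) (f : Sequence) :
    invDiff c (shift j f) = shift j (invDiff c f) := by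
  funext n
  simp only [invDiff, shift]
  have h1 : ∀ k : ℕ, n - 1 - (k : ℤ) + j = n + j - 1 - (k : ℤ) := fun k => by ring
  have h2 : ∀ k : ℕ, n + (k : ℤ) + j = n + j + (k : ℤ) := fun k => by ring
  simp only [h1, h2]

/-- `(E - 1)⁻¹` is a right inverse of `E - 1`. -/
theorem invDiff_succ (c : ℝ) {f : Sequence} (hf : f ∈ rapid) (n : ℤ) :
    invDiff c f (n + 1) = invDiff c f n + f n := by
  have h1 : ∑' k : ℕ, f (n + 1 - 1 - (k : ℤ)) = f n + ∑' k : ℕ, f (n - 1 - (k : ℤ)) := by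
    rw [(RapidlyDecreasing.summable_comp hf (injective_left (n + 1))).tsum_eq_zero_add]
    congr 1
    · simp
    · exact tsum_congr fun k => by congr 1; push_cast; ring
  have h2 : ∑' k : ℕ, f (n + (k : ℤ)) = f n + ∑' k : ℕ, f (n + 1 + (k : ℤ)) := by
    rw [(RapidlyDecreasing.summable_comp hf (injective_right n)).tsum_eq_zero_add]
    congr 1
    · simp
    · exact tsum_congr fun k => by congr 1; push_cast; ring
  simp only [invDiff, h1, h2]
  ring

/-- The difference operator `E - 1`. -/
def diff : Sequence →ₗ[ℂ] Sequence where
  toFun f := shift 1 f - f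
  map_add' f g := by funext n; simp only [shift, Pi.add_apply, Pi.sub_apply]; ring
  map_smul' a f := by
    funext n; simp only [shift, Pi.smul_apply, Pi.sub_apply, smul_eq_mul, RingHom.id_apply]; ring

theorem diff_apply (f : Sequence) (n : ℤ) : diff f n = f (n + 1) - f n := rfl

theorem diff_rapid {f : Sequence} (hf : f ∈ rapid) : diff f ∈ rapid :=
  rapid.sub_mem (shift_rapid 1 hf) hf

theorem diff_invDiff (c : ℝ) {f : Sequence} (hf : f ∈ rapid) : diff (invDiff c f) = f := by
  funext n
  rw [diff_apply, invDiff_succ c hf, add_sub_cancel_left]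

/-- Decay removes the boundary terms at both ends, and the weights 1-c and c of the two half-sums
add to 1. -/
theorem invDiff_diff (c : ℝ) {f : Sequence} (hf : f ∈ rapid) : invDiff c (diff f) = f := by
  have h : diff f = shift 1 f + (-1 : ℂ) • f := by
    funext n; simp [diff_apply, shift, sub_eq_add_neg]
  rw [h, invDiff_add c (shift_rapid 1 hf) (rapid.smul_mem _ hf), invDiff_smul, invDiff_shift]
  funext n
  simp [shift, invDiff_succ c hf]

/-- The sequences which `(E - 1)⁻¹` recovers from their differences. -/
def balanced (c : ℝ) : Submodule ℂ Sequence where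
  carrier := {x | diff x ∈ rapid ∧ invDiff c (diff x) = x}
  add_mem' {x y} hx hy := by
    refine ⟨by rw [map_add]; exact rapid.add_mem hx.1 hy.1, ?_⟩
    rw [map_add, invDiff_add c hx.1 hy.1, hx.2, hy.2]
  zero_mem' := by
    refine ⟨by rw [map_zero]; exact rapid.zero_mem, ?_⟩
    funext n
    simp [invDiff]
  smul_mem' a x hx := by
    refine ⟨by rw [map_smul]; exact rapid.smul_mem a hx.1, ?_⟩
    rw [map_smul, invDiff_smul, hx.2]

theorem rapid_balanced (c : ℝ) {f : Sequence} (hf : f ∈ rapid) : f ∈ balanced c :=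
  ⟨diff_rapid hf, invDiff_diff c hf⟩

theorem invDiff_balanced (c : ℝ) {f : Sequence} (hf : f ∈ rapid) : invDiff c f ∈ balanced c :=
  ⟨by rwa [diff_invDiff c hf], by rw [diff_invDiff c hf]⟩

/-- Only the constant 0 is recovered from its difference, so no constant of integration survives.
Later identities between nonlocal quantities are proved by checking that both sides lie in `balanced
c` and have equal differences; this works for every `c`. -/
theorem balanced_eq_zero {c : ℝ} {x : Sequence} (hx : x ∈ balanced c)
    (h : ∀ n, x (n + 1) - x n = 0) : x = 0 := by
  have h0 : diff x = 0 := funext h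
  rw [← hx.2, h0]
  funext n
  simp [invDiff]

end IDNLS

/-! ### The Lax matrix and the vanishing of the Nijenhuis torsion -/

namespace IDNLS

noncomputable section

/-! ### Entries of the Lax matrices -/

/-- Admissible complex potentials `(Q, R)`: rapidly decreasing and with `1 - Q R` nowhere zero. -/
def potentials : Set VecSequence :=
  {u | u.1 ∈ rapid ∧ u.2 ∈ rapid ∧ ∀ n, 1 - u.1 n * u.2 n ≠ 0}

/-- The space of pairs of rapidly decreasing sequences. -/
def rapidVec : Submodule ℂ VecSequence := rapid.prod rapid

theorem rapid_tendsto_zero {f : Sequence} (hf : f ∈ rapid) :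
    Filter.Tendsto f Filter.cofinite (nhds 0) := by
  obtain ⟨C, -, hC⟩ := (RapidlyDecreasing.rapidOn (s := Set.univ (α := Unit)) hf).le_weight
  have h := (summable_weight.mul_left C).tendsto_cofinite_zero
  exact squeeze_zero_norm (fun n => hC () trivial n) h

/-- 1 - QR never vanishes and tends to 1 at infinity, so its inverse converges along the cofinite
filter on `ℤ` and is bounded. -/
theorem potentials_inv_bdd {u : VecSequence} (hu : u ∈ potentials) :
    ∃ C, ∀ n, ‖(1 - u.1 n * u.2 n)⁻¹‖ ≤ C := by
  have h1 : Filter.Tendsto (fun n => ‖(1 - u.1 n * u.2 n)⁻¹‖) Filter.cofinite (nhds ‖(1:ℂ)⁻¹‖) := by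
    refine Filter.Tendsto.norm (Filter.Tendsto.inv₀ ?_ one_ne_zero)
    have h := rapid_tendsto_zero (rapid_mul_rapid hu.1 hu.2.1)
    simpa using h.const_sub 1
  obtain ⟨C, hC⟩ := h1.bddAbove_range_of_cofinite
  exact ⟨C, fun n => hC ⟨n, rfl⟩⟩

theorem rapid_div {u : VecSequence} (hu : u ∈ potentials) {f : Sequence} (hf : f ∈ rapid) :
    f / (1 - u.1 * u.2) ∈ rapid := by
  rw [div_eq_mul_inv]
  exact rapid_mul hf (potentials_inv_bdd hu).choose_spec

variable (c : ℝ) (u v f : VecSequence)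

/-- The lower right entry of the Lax matrix of `f`. -/
def laxB : Sequence := invDiff c ((u.2 * f.1 + u.1 * f.2) / (1 - u.1 * u.2))

/-- The upper left entry of the Lax matrix of `f`. -/
def laxA : Sequence := fun n =>
  -invDiff c (u.2 * shift 1 f.1 + u.1 * shift (-1) f.2) n + u.1 n * u.2 (n - 1) * laxB c u f n

/-- The upper right entry of the Lax matrix of `f`. -/
def laxP : Sequence := fun n => f.1 n - u.1 n * laxB c u f n

/-- The lower left entry of the Lax matrix of `f`. -/
def laxQ : Sequence := fun n => -f.2 (n - 1) - u.2 (n - 1) * laxB c u f n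

/-- The derivative of `laxB` in the potential, in the direction `v`. -/
def dlaxB : Sequence :=
  invDiff c ((v.2 * f.1 + v.1 * f.2) / (1 - u.1 * u.2) +
    (u.2 * f.1 + u.1 * f.2) / (1 - u.1 * u.2) * ((v.1 * u.2 + u.1 * v.2) / (1 - u.1 * u.2)))

/-- The derivative of `laxA` in the potential, in the direction `v`. -/
def dlaxA : Sequence := fun n =>
  -invDiff c (v.2 * shift 1 f.1 + v.1 * shift (-1) f.2) n +
    (v.1 n * u.2 (n - 1) + u.1 n * v.2 (n - 1)) * laxB c u f n +
    u.1 n * u.2 (n - 1) * dlaxB c u v f n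

/-- The derivative of `laxP` in the potential, in the direction `v`. -/
def dlaxP : Sequence := fun n => -v.1 n * laxB c u f n - u.1 n * dlaxB c u v f n

/-- The derivative of `laxQ` in the potential, in the direction `v`. -/
def dlaxQ : Sequence := fun n => -v.2 (n - 1) * laxB c u f n - u.2 (n - 1) * dlaxB c u v f n

/-- The derivative of `recursionL c u f` in the potential `u`, in the direction `v`. -/
def dRecursionL : VecSequence :=
  (fun n => v.1 n * laxA c u f (n + 1) + u.1 n * dlaxA c u v f (n + 1) + dlaxP c u v f (n + 1),
    fun n => -v.2 n * laxA c u f n - u.2 n * dlaxA c u v f n - dlaxQ c u v f n)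

/-- Put U = ((z, Q), (R, 1/z)) and M = ((A/z, P), (Q', zB)), where A, P, Q', B are `laxA`, `laxP`,
`laxQ`, `laxB`. The off-diagonal entries of (EM)U - UM are those of z⁻¹ Lf - z f: this formula gives
the coefficient of z⁻¹, and the definitions of P and Q' the coefficient of z. The diagonal vanishes
by `laxA_succ` and `laxB_trace`. -/
theorem recursionL_eq : recursionL c u f =
    (fun n => u.1 n * laxA c u f (n + 1) + laxP c u f (n + 1),
      fun n => -u.2 n * laxA c u f n - laxQ c u f n) := by
  refine Prod.ext (funext fun n => ?_) (funext fun n => ?_)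
  · simp only [recursionL, laxA, laxP, laxB, shift, Pi.sub_apply, Pi.mul_apply, Pi.one_apply,
      add_sub_cancel_right]
    ring
  · simp only [recursionL, laxA, laxQ, laxB, shift, Pi.add_apply, Pi.sub_apply, Pi.mul_apply,
      Pi.one_apply, ← sub_eq_add_neg n]
    ring

theorem recursionL_fst (n : ℤ) :
    (recursionL c u f).1 n = u.1 n * laxA c u f (n + 1) + laxP c u f (n + 1) := by
  rw [recursionL_eq]

theorem recursionL_snd (n : ℤ) :
    (recursionL c u f).2 n = -u.2 n * laxA c u f n - laxQ c u f n := by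
  rw [recursionL_eq]

variable {c u v f}

section rapid

variable (hu : u ∈ potentials) (hv : v ∈ rapidVec) (hf : f ∈ rapidVec)

include hu hf

theorem laxB_rapid_source : (u.2 * f.1 + u.1 * f.2) / (1 - u.1 * u.2) ∈ rapid :=
  rapid_div hu (rapid.add_mem (rapid_mul_rapid hu.2.1 hf.1) (rapid_mul_rapid hu.1 hf.2))

theorem laxA_rapid_source : u.2 * shift 1 f.1 + u.1 * shift (-1) f.2 ∈ rapid :=
  rapid.add_mem (rapid_mul_rapid hu.2.1 (shift_rapid _ hf.1))
    (rapid_mul_rapid hu.1 (shift_rapid _ hf.2))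

theorem laxB_bdd : ∃ C, ∀ n, ‖laxB c u f n‖ ≤ C := invDiff_bdd c (laxB_rapid_source hu hf)

theorem laxB_balanced : laxB c u f ∈ balanced c := invDiff_balanced c (laxB_rapid_source hu hf)

theorem laxA_balanced : laxA c u f ∈ balanced c := by
  refine (balanced c).add_mem ((balanced c).neg_mem (invDiff_balanced c (laxA_rapid_source hu hf)))
    (rapid_balanced c ?_)
  exact rapid_mul (rapid_mul_rapid hu.1 (shift_rapid (-1) hu.2.1)) (laxB_bdd hu hf).choose_spec

theorem laxA_bdd : ∃ C, ∀ n, ‖laxA c u f n‖ ≤ C := by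
  have h := laxA_balanced (c := c) hu hf
  obtain ⟨C, hC⟩ := invDiff_bdd c h.1
  exact ⟨C, fun n => by rw [← h.2]; exact hC n⟩

theorem laxP_rapid : laxP c u f ∈ rapid :=
  rapid.sub_mem hf.1 (rapid_mul hu.1 (laxB_bdd hu hf).choose_spec)

theorem laxQ_rapid : laxQ c u f ∈ rapid :=
  rapid.sub_mem (rapid.neg_mem (shift_rapid (-1) hf.2))
    (rapid_mul (shift_rapid (-1) hu.2.1) (laxB_bdd hu hf).choose_spec)

theorem recursionL_rapid : recursionL c u f ∈ rapidVec := by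
  obtain ⟨C, hC⟩ := laxA_bdd (c := c) hu hf
  rw [recursionL_eq]
  refine ⟨rapid.add_mem (rapid_mul hu.1 (g := shift 1 (laxA c u f)) fun n => hC (n + 1))
    (shift_rapid 1 (laxP_rapid hu hf)), ?_⟩
  exact rapid.sub_mem (rapid_mul (rapid.neg_mem hu.2.1) hC) (laxQ_rapid hu hf)

theorem laxB_succ (n : ℤ) : (1 - u.1 n * u.2 n) * (laxB c u f (n + 1) - laxB c u f n) =
    u.2 n * f.1 n + u.1 n * f.2 n := by
  rw [laxB, invDiff_succ c (laxB_rapid_source hu hf), add_sub_cancel_left]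
  simp only [Pi.div_apply, Pi.add_apply, Pi.mul_apply, Pi.sub_apply, Pi.one_apply]
  exact mul_div_cancel₀ _ (hu.2.2 n)

theorem laxA_succ (n : ℤ) : laxA c u f (n + 1) - laxA c u f n =
    -u.2 n * laxP c u f (n + 1) + u.1 n * laxQ c u f n := by
  simp only [laxA, laxP, laxQ]
  rw [invDiff_succ c (laxA_rapid_source hu hf)]
  simp only [Pi.add_apply, Pi.mul_apply, shift, add_sub_cancel_right, ← sub_eq_add_neg]
  ring

include hv

theorem dlaxB_rapid_source : (v.2 * f.1 + v.1 * f.2) / (1 - u.1 * u.2) +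
    (u.2 * f.1 + u.1 * f.2) / (1 - u.1 * u.2) * ((v.1 * u.2 + u.1 * v.2) / (1 - u.1 * u.2)) ∈
      rapid :=
  rapid.add_mem
    (rapid_div hu (rapid.add_mem (rapid_mul_rapid hv.2 hf.1) (rapid_mul_rapid hv.1 hf.2)))
    (rapid_mul_rapid (laxB_rapid_source hu hf)
      (rapid_div hu (rapid.add_mem (rapid_mul_rapid hv.1 hu.2.1) (rapid_mul_rapid hu.1 hv.2))))

omit hu in
theorem dlaxA_rapid_source : v.2 * shift 1 f.1 + v.1 * shift (-1) f.2 ∈ rapid :=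
  rapid.add_mem (rapid_mul_rapid hv.2 (shift_rapid _ hf.1))
    (rapid_mul_rapid hv.1 (shift_rapid _ hf.2))

theorem dlaxB_bdd : ∃ C, ∀ n, ‖dlaxB c u v f n‖ ≤ C := invDiff_bdd c (dlaxB_rapid_source hu hv hf)

theorem dlaxB_balanced : dlaxB c u v f ∈ balanced c :=
  invDiff_balanced c (dlaxB_rapid_source hu hv hf)

theorem dlaxA_balanced : dlaxA c u v f ∈ balanced c := by
  refine (balanced c).add_mem ((balanced c).add_mem
    ((balanced c).neg_mem (invDiff_balanced c (dlaxA_rapid_source hv hf)))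
    (rapid_balanced c ?_)) (rapid_balanced c ?_)
  · exact rapid_mul (rapid.add_mem (rapid_mul_rapid hv.1 (shift_rapid (-1) hu.2.1))
      (rapid_mul_rapid hu.1 (shift_rapid (-1) hv.2))) (laxB_bdd hu hf).choose_spec
  · exact rapid_mul (rapid_mul_rapid hu.1 (shift_rapid (-1) hu.2.1))
      (dlaxB_bdd hu hv hf).choose_spec

theorem dlaxA_bdd : ∃ C, ∀ n, ‖dlaxA c u v f n‖ ≤ C := by
  have h := dlaxA_balanced (c := c) hu hv hf
  obtain ⟨C, hC⟩ := invDiff_bdd c h.1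
  exact ⟨C, fun n => by rw [← h.2]; exact hC n⟩

theorem dlaxP_rapid : dlaxP c u v f ∈ rapid :=
  rapid.sub_mem (rapid_mul (rapid.neg_mem hv.1) (laxB_bdd hu hf).choose_spec)
    (rapid_mul hu.1 (dlaxB_bdd hu hv hf).choose_spec)

theorem dlaxQ_rapid : dlaxQ c u v f ∈ rapid :=
  rapid.sub_mem (rapid_mul (rapid.neg_mem (shift_rapid (-1) hv.2)) (laxB_bdd hu hf).choose_spec)
    (rapid_mul (shift_rapid (-1) hu.2.1) (dlaxB_bdd hu hv hf).choose_spec)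

theorem dRecursionL_rapid : dRecursionL c u v f ∈ rapidVec := by
  obtain ⟨C, hC⟩ := laxA_bdd (c := c) hu hf
  obtain ⟨D, hD⟩ := dlaxA_bdd (c := c) hu hv hf
  refine ⟨rapid.add_mem (rapid.add_mem
    (rapid_mul hv.1 (g := shift 1 (laxA c u f)) fun n => hC (n + 1))
    (rapid_mul hu.1 (g := shift 1 (dlaxA c u v f)) fun n => hD (n + 1)))
    (shift_rapid 1 (dlaxP_rapid hu hv hf)), ?_⟩
  exact rapid.sub_mem (rapid.sub_mem (rapid_mul (rapid.neg_mem hv.2) hC) (rapid_mul hu.2.1 hD))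
    (dlaxQ_rapid hu hv hf)

/-- This is `laxB_succ` differentiated in the potential; the last term is the variation of 1 - QR.
-/
theorem dlaxB_succ (n : ℤ) : (1 - u.1 n * u.2 n) * (dlaxB c u v f (n + 1) - dlaxB c u v f n) =
    v.2 n * f.1 n + v.1 n * f.2 n +
      (v.1 n * u.2 n + u.1 n * v.2 n) * (laxB c u f (n + 1) - laxB c u f n) := by
  rw [dlaxB, laxB, invDiff_succ c (dlaxB_rapid_source hu hv hf), add_sub_cancel_left,
    invDiff_succ c (laxB_rapid_source hu hf), add_sub_cancel_left]
  simp only [Pi.div_apply, Pi.add_apply, Pi.mul_apply, Pi.sub_apply, Pi.one_apply]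
  have := hu.2.2 n
  field_simp

omit hu in
theorem dlaxA_succ (n : ℤ) : dlaxA c u v f (n + 1) - dlaxA c u v f n =
    -v.2 n * laxP c u f (n + 1) - u.2 n * dlaxP c u v f (n + 1) + v.1 n * laxQ c u f n
      + u.1 n * dlaxQ c u v f n := by
  simp only [dlaxA, laxP, laxQ, dlaxP, dlaxQ]
  rw [invDiff_succ c (dlaxA_rapid_source hv hf)]
  simp only [Pi.add_apply, Pi.mul_apply, shift, add_sub_cancel_right, ← sub_eq_add_neg]
  ring

end rapid

/-! ### Hereditariness of the recursion operator -/

theorem dRecursionL_fst (n : ℤ) : (dRecursionL c u v f).1 n =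
    v.1 n * laxA c u f (n + 1) + u.1 n * dlaxA c u v f (n + 1) + dlaxP c u v f (n + 1) := rfl

theorem dRecursionL_snd (n : ℤ) : (dRecursionL c u v f).2 n =
    -v.2 n * laxA c u f n - u.2 n * dlaxA c u v f n - dlaxQ c u v f n := rfl

theorem laxP_apply (n : ℤ) : laxP c u f n = f.1 n - u.1 n * laxB c u f n := rfl

theorem laxQ_succ (n : ℤ) : laxQ c u f (n + 1) = -f.2 n - u.2 n * laxB c u f (n + 1) := by
  simp [laxQ]

theorem dlaxP_apply (n : ℤ) :
    dlaxP c u v f n = -v.1 n * laxB c u f n - u.1 n * dlaxB c u v f n := rfl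

theorem dlaxQ_succ (n : ℤ) :
    dlaxQ c u v f (n + 1) = -v.2 n * laxB c u f (n + 1) - u.2 n * dlaxB c u v f (n + 1) := by
  simp [dlaxQ]

theorem laxB_trace (hu : u ∈ potentials) (hf : f ∈ rapidVec) (n : ℤ) :
    u.1 n * laxQ c u f (n + 1) + laxB c u f (n + 1) - laxB c u f n - u.2 n * laxP c u f n = 0 := by
  rw [laxQ_succ, laxP_apply]
  linear_combination laxB_succ (c := c) hu hf n

theorem dlaxB_trace (hu : u ∈ potentials) (hv : v ∈ rapidVec) (hf : f ∈ rapidVec) (n : ℤ) :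
    v.1 n * laxQ c u f (n + 1) + u.1 n * dlaxQ c u v f (n + 1) + dlaxB c u v f (n + 1)
      - dlaxB c u v f n - v.2 n * laxP c u f n - u.2 n * dlaxP c u v f n = 0 := by
  rw [laxQ_succ, laxP_apply, dlaxQ_succ, dlaxP_apply]
  linear_combination dlaxB_succ (c := c) hu hv hf n

/-- The recursion operator is hereditary: its Nijenhuis torsion vanishes. -/
theorem recursionL_hereditary {f g : VecSequence} (hu : u ∈ potentials) (hf : f ∈ rapidVec)
    (hg : g ∈ rapidVec) :
    dRecursionL c u (recursionL c u g) f - dRecursionL c u (recursionL c u f) g =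
      recursionL c u (dRecursionL c u g f - dRecursionL c u f g) := by
  have hF := recursionL_rapid (c := c) hu hf
  have hG := recursionL_rapid (c := c) hu hg
  have hh : dRecursionL c u g f - dRecursionL c u f g ∈ rapidVec :=
    rapidVec.sub_mem (dRecursionL_rapid hu hg hf) (dRecursionL_rapid hu hf hg)
  have F1 := recursionL_fst c u f
  have F2 := recursionL_snd c u f
  have G1 := recursionL_fst c u g
  have G2 := recursionL_snd c u g
  -- Beyond this point `F`, `G` and `h` enter only through their pointwise formulas and their decay.
  generalize recursionL c u f = F at *
  generalize recursionL c u g = G at *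
  have h1 : ∀ n, (dRecursionL c u g f - dRecursionL c u f g).1 n =
    (dRecursionL c u g f).1 n - (dRecursionL c u f g).1 n := fun n => rfl
  have h2 : ∀ n, (dRecursionL c u g f - dRecursionL c u f g).2 n =
    (dRecursionL c u g f).2 n - (dRecursionL c u f g).2 n := fun n => rfl
  simp only [dRecursionL_fst, dRecursionL_snd] at h1 h2
  generalize dRecursionL c u g f - dRecursionL c u f g = h at *
  have f1 : ∀ n, f.1 n = laxP c u f n + u.1 n * laxB c u f n := fun n => by rw [laxP_apply]; ring
  have g1 : ∀ n, g.1 n = laxP c u g n + u.1 n * laxB c u g n := fun n => by rw [laxP_apply]; ring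
  have f2 : ∀ n, f.2 n = -laxQ c u f (n + 1) - u.2 n * laxB c u f (n + 1) := fun n => by
    rw [laxQ_succ]; ring
  have g2 : ∀ n, g.2 n = -laxQ c u g (n + 1) - u.2 n * laxB c u g (n + 1) := fun n => by
    rw [laxQ_succ]; ring
  -- Write V_f = z⁻¹ Lf - z f. The letters x, y, w, v stand for the (1,1), (1,2), (2,1), (2,2)
  -- entries of D_{V_g} M_f - D_{V_f} M_g + [M_f, M_g] - z⁻¹ M_h. The suffix 1 marks the coefficient
  -- of the highest power of z in the entry, and 0 the next one. All of them are shown to vanish.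
  have v1 : ∀ n, dlaxB c u f g n = dlaxB c u g f n := by
    have : dlaxB c u f g - dlaxB c u g f = 0 := by
      refine balanced_eq_zero (c := c) ((balanced c).sub_mem
        (dlaxB_balanced hu hf hg) (dlaxB_balanced hu hg hf)) fun n => ?_
      refine (mul_eq_zero_iff_left (hu.2.2 n)).mp ?_
      simp only [Pi.sub_apply]
      linear_combination -dlaxB_succ (c := c) hu hg hf n + dlaxB_succ (c := c) hu hf hg n
        - (laxB c u g (n + 1) - laxB c u g n) * laxB_succ (c := c) hu hf n
        + (laxB c u f (n + 1) - laxB c u f n) * laxB_succ (c := c) hu hg n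
    exact fun n => sub_eq_zero.mp (congrFun this n)
  have y1 : ∀ n, -dlaxP c u g f n + dlaxP c u f g n + laxP c u f n * laxB c u g n
      - laxP c u g n * laxB c u f n = 0 := fun n => by
    simp only [dlaxP_apply, laxP_apply, v1]; ring
  have w1 : ∀ n, -dlaxQ c u g f n + dlaxQ c u f g n + laxB c u f n * laxQ c u g n
      - laxB c u g n * laxQ c u f n = 0 := fun n => by
    simp only [dlaxQ, laxQ, v1]; ring
  have x1 : ∀ n, -dlaxA c u g f n + dlaxA c u f g n + (laxP c u f n * laxQ c u g n
      - laxP c u g n * laxQ c u f n) = 0 := by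
    have : -dlaxA c u g f + dlaxA c u f g + (laxP c u f * laxQ c u g - laxP c u g * laxQ c u f)
        = 0 := by
      refine balanced_eq_zero (c := c) ((balanced c).add_mem ((balanced c).add_mem
        ((balanced c).neg_mem (dlaxA_balanced hu hg hf)) (dlaxA_balanced hu hf hg))
        (rapid_balanced c (rapid.sub_mem (rapid_mul_rapid (laxP_rapid hu hf) (laxQ_rapid hu hg))
          (rapid_mul_rapid (laxP_rapid hu hg) (laxQ_rapid hu hf))))) fun n => ?_
      simp only [Pi.add_apply, Pi.neg_apply, Pi.sub_apply, Pi.mul_apply]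
      have e1 := dlaxA_succ (c := c) (u := u) hg hf n
      have e2 := dlaxA_succ (c := c) (u := u) hf hg n
      rw [g1, g2] at e1
      rw [f1, f2] at e2
      linear_combination -e1 + e2 - u.2 n * y1 (n + 1) + u.1 n * w1 n
    exact fun n => congrFun this n
  -- The lower off-diagonal coefficients `y0` and `w0` are at first known only as multiples of the
  -- still undetermined `v0`.
  have y0 : ∀ n, dlaxP c u G f n - dlaxP c u F g n + laxA c u f n * laxP c u g n
      - laxA c u g n * laxP c u f n - laxP c u h n = -u.1 n * (dlaxB c u G f n - dlaxB c u F g n +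
        (laxQ c u f n * laxP c u g n - laxQ c u g n * laxP c u f n) - laxB c u h n) := fun n => by
    rw [dlaxP_apply, dlaxP_apply, laxP_apply (f := h), G1, F1, h1, f1, g1]
    linear_combination -laxP c u g n * laxA_succ (c := c) hu hf n
      + laxP c u f n * laxA_succ (c := c) hu hg n + u.1 n * x1 (n + 1) + y1 (n + 1)
      + laxP c u g (n + 1) * laxB_trace (c := c) hu hf n
      - laxP c u f (n + 1) * laxB_trace (c := c) hu hg n
  have w0 : ∀ n, dlaxQ c u G f (n + 1) - dlaxQ c u F g (n + 1)
      + laxQ c u f (n + 1) * laxA c u g (n + 1) - laxQ c u g (n + 1) * laxA c u f (n + 1)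
      - laxQ c u h (n + 1) = -u.2 n * (dlaxB c u G f (n + 1) - dlaxB c u F g (n + 1) +
        (laxQ c u f (n + 1) * laxP c u g (n + 1) - laxQ c u g (n + 1) * laxP c u f (n + 1))
        - laxB c u h (n + 1)) := fun n => by
    rw [dlaxQ_succ, dlaxQ_succ, laxQ_succ (f := h), G2, F2, h2, f2, g2]
    linear_combination laxQ c u f (n + 1) * laxA_succ (c := c) hu hg n
      - laxQ c u g (n + 1) * laxA_succ (c := c) hu hf n + u.2 n * x1 n + w1 n
      + laxQ c u g n * laxB_trace (c := c) hu hf n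
      - laxQ c u f n * laxB_trace (c := c) hu hg n
  -- Inserting these multiples into the difference equation for `v0` leaves (1 - QR) times the
  -- difference of `v0`, equal to zero; this closes the loop.
  have v0 : ∀ n, dlaxB c u G f n - dlaxB c u F g n +
      (laxQ c u f n * laxP c u g n - laxQ c u g n * laxP c u f n) - laxB c u h n = 0 := by
    have : dlaxB c u G f - dlaxB c u F g + (laxQ c u f * laxP c u g - laxQ c u g * laxP c u f)
        - laxB c u h = 0 := by
      refine balanced_eq_zero (c := c) ((balanced c).sub_mem ((balanced c).add_mem
        ((balanced c).sub_mem (dlaxB_balanced hu hG hf) (dlaxB_balanced hu hF hg))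
        (rapid_balanced c (rapid.sub_mem (rapid_mul_rapid (laxQ_rapid hu hf) (laxP_rapid hu hg))
          (rapid_mul_rapid (laxQ_rapid hu hg) (laxP_rapid hu hf)))))
        (laxB_balanced hu hh)) fun n => ?_
      refine (mul_eq_zero_iff_left (hu.2.2 n)).mp ?_
      simp only [Pi.add_apply, Pi.sub_apply, Pi.mul_apply]
      have e1 := dlaxB_trace (c := c) hu hG hf n
      have e2 := dlaxB_trace (c := c) hu hF hg n
      rw [G1, G2] at e1
      rw [F1, F2] at e2
      linear_combination e1 - e2 - laxB_trace (c := c) hu hh n + u.2 n * y0 n - u.1 n * w0 n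
    exact fun n => congrFun this n
  have y0 : ∀ n, dlaxP c u G f n - dlaxP c u F g n + laxA c u f n * laxP c u g n
      - laxA c u g n * laxP c u f n - laxP c u h n = 0 := fun n => by
    rw [y0, v0, mul_zero]
  have w0 : ∀ n, dlaxQ c u G f n - dlaxQ c u F g n
      + laxQ c u f n * laxA c u g n - laxQ c u g n * laxA c u f n
      - laxQ c u h n = 0 := fun n => by
    have := w0 (n - 1)
    rwa [v0, mul_zero, sub_add_cancel] at this
  have x0 : ∀ n, dlaxA c u G f n - dlaxA c u F g n - laxA c u h n = 0 := by
    have : dlaxA c u G f - dlaxA c u F g - laxA c u h = 0 := by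
      refine balanced_eq_zero (c := c) ((balanced c).sub_mem ((balanced c).sub_mem
        (dlaxA_balanced hu hG hf) (dlaxA_balanced hu hF hg)) (laxA_balanced hu hh)) fun n => ?_
      simp only [Pi.sub_apply]
      have e1 := dlaxA_succ (c := c) (u := u) hG hf n
      have e2 := dlaxA_succ (c := c) (u := u) hF hg n
      have e3 := laxA_succ (c := c) hu hh n
      rw [G1, G2] at e1
      rw [F1, F2] at e2
      linear_combination e1 - e2 - e3 - u.2 n * y0 (n + 1) + u.1 n * w0 n
        + (laxA c u f (n + 1) - laxA c u f n) * laxA_succ (c := c) hu hg n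
        - (laxA c u g (n + 1) - laxA c u g n) * laxA_succ (c := c) hu hf n
    exact fun n => congrFun this n
  rw [recursionL_eq]
  refine Prod.ext (funext fun n => ?_) (funext fun n => ?_)
  · rw [Prod.fst_sub, Pi.sub_apply, dRecursionL_fst, dRecursionL_fst, F1, G1]
    linear_combination u.1 n * x0 (n + 1) + y0 (n + 1)
  · rw [Prod.snd_sub, Pi.sub_apply, dRecursionL_snd, dRecursionL_snd, F2, G2]
    linear_combination -u.2 n * x0 n - w0 n

end

end IDNLS

/-! ### Invertibility, linearity and phase covariance of the recursion operator -/

namespace IDNLS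

noncomputable section

variable {c : ℝ} {u v f g : VecSequence}

/-! ### The inverse of the recursion operator -/

theorem swap_potentials (hu : u ∈ potentials) : u.swap ∈ potentials :=
  ⟨hu.2.1, hu.1, fun n => by rw [mul_comm]; exact hu.2.2 n⟩

/-- The symmetry exchanging `Q` and `R` turns every statement about `L` into one about `L⁻¹`. -/
theorem recursionLInv_eq_swap :
    recursionLInv c u v = (recursionL c u.swap v.swap).swap := by
  simp only [recursionLInv, recursionL, Prod.fst_swap, Prod.snd_swap, Prod.swap_prod_mk]
  rw [add_comm (u.1 * shift 1 v.2), add_comm (u.1 * v.2), mul_comm u.2 u.1]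

theorem recursionLInv_rapid (hu : u ∈ potentials) (hv : v ∈ rapidVec) :
    recursionLInv c u v ∈ rapidVec := by
  rw [recursionLInv_eq_swap]
  exact (recursionL_rapid (swap_potentials hu) (f := v.swap) hv.symm).symm

theorem invDiff_eq_of_diff {x f : Sequence} (hx : x ∈ balanced c) (h : f = diff x) :
    invDiff c f = x := h ▸ hx.2

/-- The two integrands of `L⁻¹` evaluated at Lf are exact differences, by the diagonal Lax
equations. Their integrals are therefore local expressions in `laxA` and `laxB`, and what remains is
the definition of `laxP` and `laxQ`. -/
theorem recursionLInv_recursionL (hu : u ∈ potentials) (hf : f ∈ rapidVec) :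
    recursionLInv c u (recursionL c u f) = f := by
  have hα := laxA_balanced (c := c) hu hf
  have hb : invDiff c ((u.2 * (recursionL c u f).1 + u.1 * (recursionL c u f).2) / (1 - u.1 * u.2))
      = -laxA c u f := by
    refine invDiff_eq_of_diff ((balanced c).neg_mem hα) (funext fun n => ?_)
    simp only [Pi.div_apply, Pi.add_apply, Pi.mul_apply, Pi.sub_apply, Pi.one_apply, diff_apply,
      Pi.neg_apply, recursionL_fst, recursionL_snd]
    rw [div_eq_iff (hu.2.2 n)]
    linear_combination laxA_succ (c := c) hu hf n
  have ha : invDiff c (u.2 * shift (-1) (recursionL c u f).1 + u.1 * shift 1 (recursionL c u f).2)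
      = laxB c u f - shift (-1) u.1 * u.2 * laxA c u f := by
    refine invDiff_eq_of_diff ((balanced c).sub_mem (laxB_balanced hu hf) (rapid_balanced c
      (rapid_mul (rapid_mul_rapid (shift_rapid (-1) hu.1) hu.2.1)
        (laxA_bdd hu hf).choose_spec))) (funext fun n => ?_)
    have h1 := laxB_trace (c := c) hu hf n
    simp only [Pi.add_apply, Pi.mul_apply, Pi.sub_apply, diff_apply, shift, ← sub_eq_add_neg n,
      recursionL_fst, recursionL_snd, sub_add_cancel, add_sub_cancel_right, ← sub_eq_add_neg (n + 1)]
    linear_combination -h1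
  simp only [recursionLInv, hb, ha]
  refine Prod.ext (funext fun n => ?_) (funext fun n => ?_)
  · have h := laxP_apply (c := c) (u := u) (f := f) n
    simp only [Pi.add_apply, Pi.mul_apply, Pi.sub_apply, Pi.one_apply, Pi.neg_apply, shift,
      recursionL_fst, ← sub_eq_add_neg n, sub_add_cancel]
    linear_combination h
  · have h := laxQ_succ (c := c) (u := u) (f := f) n
    simp only [Pi.mul_apply, Pi.sub_apply, Pi.one_apply, Pi.neg_apply, shift,
      recursionL_snd, ← sub_eq_add_neg (n + 1), add_sub_cancel_right]
    linear_combination -h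

theorem recursionL_recursionLInv (hu : u ∈ potentials) (hf : f ∈ rapidVec) :
    recursionL c u (recursionLInv c u f) = f := by
  have h := recursionLInv_recursionL (c := c) (swap_potentials hu) (f := f.swap) hf.symm
  rw [recursionLInv_eq_swap] at h ⊢
  simpa using congrArg Prod.swap h

/-! ### Linearity -/

theorem laxB_add (hu : u ∈ potentials) (hf : f ∈ rapidVec) (hg : g ∈ rapidVec) :
    laxB c u (f + g) = laxB c u f + laxB c u g := by
  rw [laxB, laxB, laxB, ← invDiff_add c (laxB_rapid_source hu hf) (laxB_rapid_source hu hg)]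
  congr 1
  funext n
  simp only [Prod.fst_add, Prod.snd_add, Pi.div_apply, Pi.add_apply, Pi.mul_apply]
  ring

theorem laxB_smul (a : ℂ) : laxB c u (a • f) = a • laxB c u f := by
  rw [laxB, laxB, ← invDiff_smul]
  congr 1
  funext n
  simp only [Prod.smul_fst, Prod.smul_snd, Pi.smul_apply, Pi.div_apply, Pi.add_apply, Pi.mul_apply,
    smul_eq_mul]
  ring

theorem laxA_add (hu : u ∈ potentials) (hf : f ∈ rapidVec) (hg : g ∈ rapidVec) :
    laxA c u (f + g) = laxA c u f + laxA c u g := by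
  have h : u.2 * shift 1 (f + g).1 + u.1 * shift (-1) (f + g).2 =
      (u.2 * shift 1 f.1 + u.1 * shift (-1) f.2) + (u.2 * shift 1 g.1 + u.1 * shift (-1) g.2) := by
    funext n
    simp only [shift, Prod.fst_add, Prod.snd_add, Pi.add_apply, Pi.mul_apply]
    ring
  funext n
  simp only [laxA, laxB_add hu hf hg, h,
    invDiff_add c (laxA_rapid_source hu hf) (laxA_rapid_source hu hg), Pi.add_apply]
  ring

theorem laxA_smul (a : ℂ) : laxA c u (a • f) = a • laxA c u f := by
  have h : u.2 * shift 1 (a • f).1 + u.1 * shift (-1) (a • f).2 =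
      a • (u.2 * shift 1 f.1 + u.1 * shift (-1) f.2) := by
    funext n
    simp only [shift, Prod.smul_fst, Prod.smul_snd, Pi.add_apply, Pi.mul_apply, Pi.smul_apply,
      smul_eq_mul]
    ring
  funext n
  simp only [laxA, laxB_smul, h, invDiff_smul, Pi.smul_apply, smul_eq_mul]
  ring

theorem recursionL_add (hu : u ∈ potentials) (hf : f ∈ rapidVec) (hg : g ∈ rapidVec) :
    recursionL c u (f + g) = recursionL c u f + recursionL c u g := by
  simp only [recursionL_eq, laxP, laxQ, laxA_add hu hf hg, laxB_add hu hf hg]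
  refine Prod.ext (funext fun n => ?_) (funext fun n => ?_) <;>
  · simp only [Prod.fst_add, Prod.snd_add, Pi.add_apply]
    ring

theorem recursionL_smul (a : ℂ) : recursionL c u (a • f) = a • recursionL c u f := by
  simp only [recursionL_eq, laxP, laxQ, laxA_smul, laxB_smul]
  refine Prod.ext (funext fun n => ?_) (funext fun n => ?_) <;>
  · simp only [Prod.smul_fst, Prod.smul_snd, Pi.smul_apply, smul_eq_mul]
    ring

section bilinear

variable {w : VecSequence} (hu : u ∈ potentials) (hv : v ∈ rapidVec) (hw : w ∈ rapidVec)
  (hf : f ∈ rapidVec) (hg : g ∈ rapidVec)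

include hu hv hf

theorem dlaxB_add_right (hg : g ∈ rapidVec) :
    dlaxB c u v (f + g) = dlaxB c u v f + dlaxB c u v g := by
  rw [dlaxB, dlaxB, dlaxB,
    ← invDiff_add c (dlaxB_rapid_source hu hv hf) (dlaxB_rapid_source hu hv hg)]
  congr 1
  funext n
  simp only [Prod.fst_add, Prod.snd_add, Pi.div_apply, Pi.add_apply, Pi.mul_apply]
  ring

theorem dlaxB_add_left (hw : w ∈ rapidVec) :
    dlaxB c u (v + w) f = dlaxB c u v f + dlaxB c u w f := by
  rw [dlaxB, dlaxB, dlaxB,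
    ← invDiff_add c (dlaxB_rapid_source hu hv hf) (dlaxB_rapid_source hu hw hf)]
  congr 1
  funext n
  simp only [Prod.fst_add, Prod.snd_add, Pi.div_apply, Pi.add_apply, Pi.mul_apply]
  ring

theorem dlaxA_add_right (hg : g ∈ rapidVec) :
    dlaxA c u v (f + g) = dlaxA c u v f + dlaxA c u v g := by
  have h : v.2 * shift 1 (f + g).1 + v.1 * shift (-1) (f + g).2 =
      (v.2 * shift 1 f.1 + v.1 * shift (-1) f.2) + (v.2 * shift 1 g.1 + v.1 * shift (-1) g.2) := by
    funext n
    simp only [shift, Prod.fst_add, Prod.snd_add, Pi.add_apply, Pi.mul_apply]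
    ring
  funext n
  simp only [dlaxA, laxB_add hu hf hg, dlaxB_add_right hu hv hf hg, h,
    invDiff_add c (dlaxA_rapid_source hv hf) (dlaxA_rapid_source hv hg), Pi.add_apply]
  ring

theorem dlaxA_add_left (hw : w ∈ rapidVec) :
    dlaxA c u (v + w) f = dlaxA c u v f + dlaxA c u w f := by
  have h : (v + w).2 * shift 1 f.1 + (v + w).1 * shift (-1) f.2 =
      (v.2 * shift 1 f.1 + v.1 * shift (-1) f.2) + (w.2 * shift 1 f.1 + w.1 * shift (-1) f.2) := by
    funext n
    simp only [shift, Prod.fst_add, Prod.snd_add, Pi.add_apply, Pi.mul_apply]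
    ring
  funext n
  simp only [dlaxA, dlaxB_add_left hu hv hf hw, h, Pi.add_apply]
  simp only [invDiff_add c (dlaxA_rapid_source hv hf) (dlaxA_rapid_source hw hf), Pi.add_apply,
    Prod.fst_add, Prod.snd_add]
  ring

theorem dRecursionL_add_right (hg : g ∈ rapidVec) :
    dRecursionL c u v (f + g) = dRecursionL c u v f + dRecursionL c u v g := by
  simp only [dRecursionL, dlaxP, dlaxQ, laxA_add hu hf hg, laxB_add hu hf hg,
    dlaxA_add_right hu hv hf hg, dlaxB_add_right hu hv hf hg]
  refine Prod.ext (funext fun n => ?_) (funext fun n => ?_) <;>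
  · simp only [Prod.fst_add, Prod.snd_add, Pi.add_apply]
    ring

theorem dRecursionL_add_left (hw : w ∈ rapidVec) :
    dRecursionL c u (v + w) f = dRecursionL c u v f + dRecursionL c u w f := by
  simp only [dRecursionL, dlaxP, dlaxQ, dlaxA_add_left hu hv hf hw, dlaxB_add_left hu hv hf hw]
  refine Prod.ext (funext fun n => ?_) (funext fun n => ?_) <;>
  · simp only [Prod.fst_add, Prod.snd_add, Pi.add_apply]
    ring

end bilinear

theorem dlaxB_smul_right (a : ℂ) : dlaxB c u v (a • f) = a • dlaxB c u v f := by
  rw [dlaxB, dlaxB, ← invDiff_smul]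
  congr 1
  funext n
  simp only [Prod.smul_fst, Prod.smul_snd, Pi.smul_apply, Pi.div_apply, Pi.add_apply, Pi.mul_apply,
    smul_eq_mul]
  ring

theorem dlaxB_smul_left (a : ℂ) : dlaxB c u (a • v) f = a • dlaxB c u v f := by
  rw [dlaxB, dlaxB, ← invDiff_smul]
  congr 1
  funext n
  simp only [Prod.smul_fst, Prod.smul_snd, Pi.smul_apply, Pi.div_apply, Pi.add_apply, Pi.mul_apply,
    smul_eq_mul]
  ring

theorem dlaxA_smul_right (a : ℂ) : dlaxA c u v (a • f) = a • dlaxA c u v f := by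
  have h : v.2 * shift 1 (a • f).1 + v.1 * shift (-1) (a • f).2 =
      a • (v.2 * shift 1 f.1 + v.1 * shift (-1) f.2) := by
    funext n
    simp only [shift, Prod.smul_fst, Prod.smul_snd, Pi.add_apply, Pi.mul_apply, Pi.smul_apply,
      smul_eq_mul]
    ring
  funext n
  simp only [dlaxA, laxB_smul, dlaxB_smul_right, h, invDiff_smul, Pi.smul_apply, smul_eq_mul]
  ring

theorem dlaxA_smul_left (a : ℂ) : dlaxA c u (a • v) f = a • dlaxA c u v f := by
  have h : (a • v).2 * shift 1 f.1 + (a • v).1 * shift (-1) f.2 =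
      a • (v.2 * shift 1 f.1 + v.1 * shift (-1) f.2) := by
    funext n
    simp only [shift, Prod.smul_fst, Prod.smul_snd, Pi.add_apply, Pi.mul_apply, Pi.smul_apply,
      smul_eq_mul]
    ring
  funext n
  simp only [dlaxA, dlaxB_smul_left, h, Pi.smul_apply]
  simp only [invDiff_smul, Pi.smul_apply, smul_eq_mul, Prod.smul_fst,
    Prod.smul_snd]
  ring

theorem dRecursionL_smul_right (a : ℂ) :
    dRecursionL c u v (a • f) = a • dRecursionL c u v f := by
  simp only [dRecursionL, dlaxP, dlaxQ, laxA_smul, laxB_smul, dlaxA_smul_right, dlaxB_smul_right]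
  refine Prod.ext (funext fun n => ?_) (funext fun n => ?_) <;>
  · simp only [Prod.smul_fst, Prod.smul_snd, Pi.smul_apply, smul_eq_mul]
    ring

theorem dRecursionL_smul_left (a : ℂ) :
    dRecursionL c u (a • v) f = a • dRecursionL c u v f := by
  simp only [dRecursionL, dlaxP, dlaxQ, dlaxA_smul_left, dlaxB_smul_left]
  refine Prod.ext (funext fun n => ?_) (funext fun n => ?_) <;>
  · simp only [Prod.smul_fst, Prod.smul_snd, Pi.smul_apply, smul_eq_mul]
    ring

/-- The recursion operator as an automorphism of the space of rapidly decreasing pairs. -/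
def recL (c : ℝ) (u : potentials) : rapidVec ≃ₗ[ℂ] rapidVec where
  toFun f := ⟨recursionL c u f, recursionL_rapid u.2 f.2⟩
  invFun f := ⟨recursionLInv c u f, recursionLInv_rapid u.2 f.2⟩
  map_add' f g := Subtype.ext (recursionL_add u.2 f.2 g.2)
  map_smul' a _ := Subtype.ext (recursionL_smul a)
  left_inv f := Subtype.ext (recursionLInv_recursionL u.2 f.2)
  right_inv f := Subtype.ext (recursionL_recursionLInv u.2 f.2)

/-- The derivative of the recursion operator in the potential, `dRecL c u v f = L'[v] f`. -/
def dRecL (c : ℝ) (u : potentials) : rapidVec →ₗ[ℂ] rapidVec →ₗ[ℂ] rapidVec :=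
  LinearMap.mk₂ ℂ (fun v f => ⟨dRecursionL c u v f, dRecursionL_rapid u.2 v.2 f.2⟩)
    (fun v w f => Subtype.ext (dRecursionL_add_left u.2 v.2 f.2 w.2))
    (fun a _ _ => Subtype.ext (dRecursionL_smul_left a))
    (fun v f g => Subtype.ext (dRecursionL_add_right u.2 v.2 f.2 g.2))
    (fun a _ _ => Subtype.ext (dRecursionL_smul_right a))

theorem recL_hereditary (c : ℝ) (u : potentials) (f g : rapidVec) :
    dRecL c u (recL c u g) f - dRecL c u (recL c u f) g =
      recL c u (dRecL c u g f - dRecL c u f g) :=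
  Subtype.ext (recursionL_hereditary u.2 f.2 g.2)

/-! ### Phase rotations with linear weight -/

theorem affine_mul_rapid (κ a : ℂ) {f : Sequence} (hf : f ∈ rapid) :
    (fun n : ℤ => (κ * n + a) * f n : Sequence) ∈ rapid := by
  have h := rapid.add_mem (rapid.smul_mem κ (index_mul_rapid hf)) (rapid.smul_mem a hf)
  convert h using 1
  funext n
  simp only [Pi.add_apply, Pi.smul_apply, smul_eq_mul]
  ring

/-- Multiplication by `(κ n + a) diag(1, -1)`. -/
def twist (κ a : ℂ) : rapidVec →ₗ[ℂ] rapidVec where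
  toFun f := ⟨(fun n => (κ * n + a) * f.1.1 n, fun n => -((κ * n + a) * f.1.2 n)),
    affine_mul_rapid κ a f.2.1, rapid.neg_mem (affine_mul_rapid κ a f.2.2)⟩
  map_add' f g := by
    refine Subtype.ext (Prod.ext (funext fun n => ?_) (funext fun n => ?_)) <;>
    · simp only [Submodule.coe_add, Prod.fst_add, Prod.snd_add, Pi.add_apply]
      ring
  map_smul' b f := by
    refine Subtype.ext (Prod.ext (funext fun n => ?_) (funext fun n => ?_)) <;>
    · simp only [Submodule.coe_smul, Prod.smul_fst, Prod.smul_snd, Pi.smul_apply, smul_eq_mul,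
        RingHom.id_apply]
      ring

/-- A potential as a rapidly decreasing pair. -/
def potentialVec (u : potentials) : rapidVec := ⟨u, u.2.1, u.2.2.1⟩

/-- The Lie derivative of the recursion operator along a phase rotation with linear weight. -/
theorem dRecL_twist (c : ℝ) (u : potentials) (κ a : ℂ) (f : rapidVec) :
    dRecL c u (twist κ a (potentialVec u)) f =
      twist κ a (recL c u f) - recL c u (twist κ a f) + κ • recL c u f := by
  obtain ⟨u, hu⟩ := u
  obtain ⟨f, hf⟩ := f
  set v := twist κ a (potentialVec ⟨u, hu⟩) with hvdef
  set W := twist κ a ⟨f, hf⟩ with hWdef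
  have v1 : ∀ n, v.1.1 n = (κ * n + a) * u.1 n := fun n => rfl
  have v2 : ∀ n, v.1.2 n = -((κ * n + a) * u.2 n) := fun n => rfl
  have W1 : ∀ n, W.1.1 n = (κ * n + a) * f.1 n := fun n => rfl
  have W2 : ∀ n, W.1.2 n = -((κ * n + a) * f.2 n) := fun n => rfl
  -- Opposite phases cancel in the products of potential and argument at the same site, so the
  -- source of `laxB` is invariant under the rotation.
  have hB : ∀ n, dlaxB c u v f n = -laxB c u W n := by
    have : dlaxB c u v f = (-1 : ℂ) • laxB c u W := by
      rw [dlaxB, laxB, ← invDiff_smul]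
      congr 1
      funext n
      simp only [Pi.smul_apply, Pi.div_apply, Pi.add_apply, Pi.mul_apply, smul_eq_mul, v1, v2, W1,
        W2]
      ring
    intro n
    rw [this]
    simp
  -- In the source of `laxA` the two factors sit at neighbouring sites, and the phases differ by
  -- exactly κ. This is the only origin of the factor κ.
  have hA : ∀ n, dlaxA c u v f n = κ * laxA c u f n - laxA c u W n := by
    have h : invDiff c (v.1.2 * shift 1 f.1 + v.1.1 * shift (-1) f.2) =
        κ • invDiff c (u.2 * shift 1 f.1 + u.1 * shift (-1) f.2) +
          (-1 : ℂ) • invDiff c (u.2 * shift 1 W.1.1 + u.1 * shift (-1) W.1.2) := by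
      rw [← invDiff_smul, ← invDiff_smul, ← invDiff_add c
        (rapid.smul_mem _ (laxA_rapid_source hu hf)) (rapid.smul_mem _ (laxA_rapid_source hu W.2))]
      congr 1
      funext n
      simp only [Pi.smul_apply, Pi.add_apply, Pi.mul_apply, smul_eq_mul, shift, v1, v2, W1, W2]
      push_cast
      ring
    intro n
    simp only [dlaxA, h, hB, laxA, Pi.add_apply, Pi.smul_apply, smul_eq_mul, v1, v2]
    push_cast
    ring
  refine Subtype.ext (Prod.ext (funext fun n => ?_) (funext fun n => ?_))
  · change (dRecursionL c u v f).1 n = (κ * n + a) * (recursionL c u f).1 n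
      - (recursionL c u W).1 n + κ * (recursionL c u f).1 n
    rw [dRecursionL_fst, recursionL_fst, recursionL_fst, dlaxP_apply, laxP_apply, laxP_apply, hA,
      hB, v1, v1, W1]
    push_cast
    ring
  · change (dRecursionL c u v f).2 n = -((κ * n + a) * (recursionL c u f).2 n)
      - (recursionL c u W).2 n + κ * (recursionL c u f).2 n
    rw [dRecursionL_snd, recursionL_snd, recursionL_snd, dlaxQ, laxQ, laxQ, hA, hB, v2, v2, W2]
    push_cast
    ring

end

end IDNLS

/-! ### Formal consequences of heredity, and the Laurent polynomial model -/

namespace IDNLS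

noncomputable section

/-! ### First order jets of vector fields at a point

A vector field near a point of a vector space has a value and a derivative there; such pairs are
acted upon by a hereditary operator. -/

section jets

variable {H : Type*} [AddCommGroup H] [Module ℂ H]

/-- The value and the derivative of a vector field at a point. -/
abbrev Jet (H : Type*) [AddCommGroup H] [Module ℂ H] : Type _ := H × (H →ₗ[ℂ] H)

/-- The Lie product `x'[y] - y'[x]`. -/
def jetBracket : Jet H →ₗ[ℂ] Jet H →ₗ[ℂ] H :=
  LinearMap.mk₂ ℂ (fun x y => x.2 y.1 - y.2 x.1)
    (fun x x' y => by
      simp only [Prod.fst_add, Prod.snd_add, LinearMap.add_apply, map_add]; abel)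
    (fun a x y => by
      simp only [Prod.smul_fst, Prod.smul_snd, LinearMap.smul_apply, map_smul, smul_sub])
    (fun x y y' => by
      simp only [Prod.fst_add, Prod.snd_add, LinearMap.add_apply, map_add]; abel)
    (fun a x y => by
      simp only [Prod.smul_fst, Prod.smul_snd, LinearMap.smul_apply, map_smul, smul_sub])

theorem jetBracket_apply (x y : Jet H) : jetBracket x y = x.2 y.1 - y.2 x.1 := rfl

theorem jetBracket_swap (x y : Jet H) : jetBracket x y = -jetBracket y x := by
  rw [jetBracket_apply, jetBracket_apply, neg_sub]

variable (L : H ≃ₗ[ℂ] H) (dL : H →ₗ[ℂ] H →ₗ[ℂ] H)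

/-- The action on jets of an operator `L` depending on the point, with derivative `dL`. -/
def jetL : Jet H ≃ₗ[ℂ] Jet H where
  toFun x := (L x.1, dL.flip x.1 + L.toLinearMap ∘ₗ x.2)
  invFun y := (L.symm y.1, L.symm.toLinearMap ∘ₗ (y.2 - dL.flip (L.symm y.1)))
  map_add' x y := by
    refine Prod.ext (map_add _ _ _) (LinearMap.ext fun v => ?_)
    simp only [Prod.fst_add, Prod.snd_add, map_add, LinearMap.add_apply, LinearMap.comp_apply,
      LinearEquiv.coe_coe]
    abel
  map_smul' a x := by
    refine Prod.ext (map_smul _ _ _) (LinearMap.ext fun v => ?_)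
    simp only [Prod.smul_fst, Prod.smul_snd, map_smul, LinearMap.add_apply, LinearMap.comp_apply,
      LinearEquiv.coe_coe, LinearMap.smul_apply, RingHom.id_apply, smul_add]
  left_inv x := by
    refine Prod.ext (L.symm_apply_apply _) (LinearMap.ext fun v => ?_)
    simp
  right_inv y := by
    refine Prod.ext (L.apply_symm_apply _) (LinearMap.ext fun v => ?_)
    simp

/-- The Lie derivative of `L` along a vector field, up to sign. -/
def lieDer (x : Jet H) : H →ₗ[ℂ] H := dL x.1 - x.2 ∘ₗ L.toLinearMap + L.toLinearMap ∘ₗ x.2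

variable {L dL}

theorem lieDer_apply (x : Jet H) (f : H) :
    lieDer L dL x f = dL x.1 f - x.2 (L f) + L (x.2 f) := rfl

theorem jetL_fst (x : Jet H) : (jetL L dL x).1 = L x.1 := rfl

theorem jetL_snd (x : Jet H) (v : H) : (jetL L dL x).2 v = dL v x.1 + L (x.2 v) := rfl

theorem jetL_zpow_fst (a : ℤ) (x : Jet H) : ((jetL L dL ^ a) x).1 = (L ^ a) x.1 := by
  induction a using Int.induction_on generalizing x with
  | zero => rfl
  | succ n ih => rw [zpow_add_one, zpow_add_one, LinearEquiv.mul_apply, ih]; rfl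
  | pred n ih => rw [zpow_sub_one, zpow_sub_one, LinearEquiv.mul_apply, ih]; rfl

/-- The product rule: bracketing with `y` passes through `L` at the cost of the Lie derivative of
`L` along `y`. -/
theorem jetBracket_jetL (x y : Jet H) :
    jetBracket (jetL L dL x) y = L (jetBracket x y) + lieDer L dL y x.1 := by
  rw [jetBracket_apply, jetBracket_apply, jetL_snd, jetL_fst, lieDer_apply, map_sub]
  abel

/-- This is the torsion condition read as a statement on Lie derivatives: replacing a field x by Lx
multiplies the Lie derivative of `L` by `L` on the left. -/
theorem lieDer_jetL (hL : ∀ f g, dL (L g) f - dL (L f) g = L (dL g f - dL f g)) (x : Jet H) :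
    lieDer L dL (jetL L dL x) = L.toLinearMap ∘ₗ lieDer L dL x := by
  ext f
  have h := hL f x.1
  rw [map_sub, sub_eq_iff_eq_add] at h
  rw [LinearMap.comp_apply, LinearEquiv.coe_coe, lieDer_apply, lieDer_apply, jetL_fst, jetL_snd,
    jetL_snd, h]
  simp only [map_add, map_sub]
  abel

theorem lieDer_jetL_zpow (hL : ∀ f g, dL (L g) f - dL (L f) g = L (dL g f - dL f g)) (a : ℤ)
    (x : Jet H) (f : H) : lieDer L dL ((jetL L dL ^ a) x) f = (L ^ a) (lieDer L dL x f) := by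
  induction a using Int.induction_on with
  | zero => rfl
  | succ n ih =>
    rw [add_comm, zpow_one_add, zpow_one_add, LinearEquiv.mul_apply, LinearEquiv.mul_apply, ← ih,
      lieDer_jetL hL]
    rfl
  | pred n ih =>
    apply L.injective
    have h : L ((L ^ (-(n : ℤ) - 1)) (lieDer L dL x f)) = (L ^ (-(n : ℤ))) (lieDer L dL x f) := by
      rw [← LinearEquiv.mul_apply, ← zpow_one_add]
      congr 2
      ring
    rw [h, ← ih]
    have h2 : (jetL L dL ^ (-(n : ℤ))) x = jetL L dL ((jetL L dL ^ (-(n : ℤ) - 1)) x) := by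
      rw [← LinearEquiv.mul_apply, ← zpow_one_add]
      congr 2
      ring
    rw [h2, lieDer_jetL hL]
    rfl

/-- Each application of `L` adds one term μ L^(a+b) x, so their number is `a`. For negative `a` the
same step is read backwards, using injectivity of `L`. -/
theorem jetBracket_jetL_zpow {y : Jet H} {μ : ℂ} {b : ℤ}
    (hy : ∀ f, lieDer L dL y f = μ • (L ^ (b + 1)) f) (a : ℤ) (x : Jet H) :
    jetBracket ((jetL L dL ^ a) x) y =
      (L ^ a) (jetBracket x y) + (a * μ) • (L ^ (a + b)) x.1 := by
  have step : ∀ a : ℤ, jetBracket ((jetL L dL ^ (a + 1)) x) y =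
      L (jetBracket ((jetL L dL ^ a) x) y) + μ • (L ^ (a + 1 + b)) x.1 := fun a => by
    rw [add_comm a 1, zpow_one_add, LinearEquiv.mul_apply, jetBracket_jetL, hy, jetL_zpow_fst,
      ← LinearEquiv.mul_apply, ← zpow_add]
    congr 4
    ring
  have comp : ∀ (b : ℤ) (z : H), L ((L ^ b) z) = (L ^ (b + 1)) z := fun b z => by
    rw [add_comm, zpow_one_add]; rfl
  induction a using Int.induction_on with
  | zero => simp
  | succ n ih =>
    rw [step, ih, map_add, map_smul, comp, comp, add_right_comm (n : ℤ) b 1]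
    push_cast
    module
  | pred n ih =>
    have h := step (-(n : ℤ) - 1)
    rw [sub_add_cancel, ih] at h
    apply L.injective
    rw [map_add, map_smul, comp, comp, add_right_comm _ b 1, sub_add_cancel]
    rw [← sub_eq_iff_eq_add] at h
    rw [← h]
    push_cast
    module

/-- The power of `L` is removed first from x, then from y after exchanging the arguments; the
remaining bracket of x and y is zero. -/
theorem jetBracket_zpow_zpow (hL : ∀ f g, dL (L g) f - dL (L f) g = L (dL g f - dL f g))
    {x y : Jet H} {κ μ : ℂ} (hx : ∀ f, lieDer L dL x f = κ • L f)
    (hy : ∀ f, lieDer L dL y f = μ • L f) (hxy : jetBracket x y = 0) (a b : ℤ) :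
    jetBracket ((jetL L dL ^ a) x) ((jetL L dL ^ b) y) =
      (a * μ) • (L ^ (a + b)) x.1 - (b * κ) • (L ^ (a + b)) y.1 := by
  have hy' : ∀ f, lieDer L dL ((jetL L dL ^ b) y) f = μ • (L ^ (b + 1)) f := fun f => by
    rw [lieDer_jetL_zpow hL, hy, map_smul, zpow_add_one]; rfl
  have hx' : ∀ f, lieDer L dL x f = κ • (L ^ ((0 : ℤ) + 1)) f := fun f => by
    rw [hx, zero_add, zpow_one]
  rw [jetBracket_jetL_zpow hy', jetBracket_swap, jetBracket_jetL_zpow hx', jetBracket_swap, hxy,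
    neg_zero, map_zero, zero_add, map_neg, map_smul, ← LinearEquiv.mul_apply, ← zpow_add, add_zero]
  abel

end jets

/-! ### The model Lie algebra: Laurent polynomials -/

open LaurentPolynomial

/-- The linear map on Laurent polynomials with prescribed values on the monomials. -/
def laurentLift {M : Type*} [AddCommGroup M] [Module ℂ M] (x : ℤ → M) : ℂ[T;T⁻¹] →ₗ[ℂ] M :=
  Finsupp.linearCombination ℂ x ∘ₗ (AddMonoidAlgebra.coeffLinearEquiv ℂ).toLinearMap

theorem laurentLift_T {M : Type*} [AddCommGroup M] [Module ℂ M] (x : ℤ → M) (n : ℤ) :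
    laurentLift x (T n) = x n := by
  change Finsupp.linearCombination ℂ x (Finsupp.single n 1) = x n
  simp

theorem laurent_induction {motive : ℂ[T;T⁻¹] → Prop} (p : ℂ[T;T⁻¹])
    (add : ∀ p q, motive p → motive q → motive (p + q))
    (smul : ∀ (a : ℂ) (p), motive p → motive (a • p)) (mono : ∀ n, motive (T n)) : motive p := by
  induction p using LaurentPolynomial.induction_on' with
  | add p q hp hq => exact add p q hp hq
  | C_mul_T n a => rw [← smul_eq_C_mul]; exact smul a _ (mono n)

/-- The Euler derivation `T d/dT` on Laurent polynomials. -/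
def euler : Derivation ℂ ℂ[T;T⁻¹] ℂ[T;T⁻¹] :=
  Derivation.mk' (laurentLift fun n => (n : ℂ) • T n) fun p q => by
    induction p using laurent_induction with
    | add p p' hp hp' =>
      rw [add_mul, map_add, hp, hp', map_add, smul_add, add_smul]
      abel
    | smul a p hp =>
      rw [smul_mul_assoc, map_smul, hp, map_smul]
      simp only [smul_eq_mul, smul_add, smul_mul_assoc, mul_smul_comm]
    | mono n =>
      induction q using laurent_induction with
      | add q q' hq hq' =>
        rw [mul_add, map_add, hq, hq', map_add, smul_add, add_smul]
        abel
      | smul a q hq =>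
        rw [mul_smul_comm, map_smul, hq, map_smul]
        simp only [smul_eq_mul, smul_add, smul_mul_assoc, mul_smul_comm]
      | mono m =>
        rw [← T_add, laurentLift_T, laurentLift_T, laurentLift_T]
        simp only [smul_eq_mul, mul_smul_comm, ← T_add, add_comm m n]
        push_cast
        module

theorem euler_T (n : ℤ) : euler (T n) = (n : ℂ) • T n := laurentLift_T _ n

/-- Laurent polynomials `(p, q)` stand for the vector field `p(L) K + q(L) σ`. -/
abbrev Model : Type := ℂ[T;T⁻¹] × ℂ[T;T⁻¹]

/-- The Lie bracket of the model. -/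
def modelBracket (x y : Model) : Model :=
  (euler x.1 * y.2 - euler y.1 * x.2, euler x.2 * y.2 - euler y.2 * x.2)

/-- Up to sign, the model is the semidirect product of the derivations q·T d/dT with the Laurent
polynomials p as an abelian ideal. Jets record only first derivatives, so the Jacobi identity of the
flows is taken from here. -/
theorem modelBracket_jacobi (x y z : Model) :
    modelBracket x (modelBracket y z) + modelBracket y (modelBracket z x) +
      modelBracket z (modelBracket x y) = 0 := by
  refine Prod.ext ?_ ?_ <;>
  · simp only [modelBracket, Prod.fst_add, Prod.snd_add, map_sub, Derivation.leibniz, smul_eq_mul,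
      Prod.fst_zero, Prod.snd_zero]
    ring

theorem modelBracket_add_left (x x' y : Model) :
    modelBracket (x + x') y = modelBracket x y + modelBracket x' y := by
  refine Prod.ext ?_ ?_ <;>
  · simp only [modelBracket, Prod.fst_add, Prod.snd_add, map_add]
    ring

theorem modelBracket_smul_left (a : ℂ) (x y : Model) :
    modelBracket (a • x) y = a • modelBracket x y := by
  refine Prod.ext ?_ ?_ <;>
  · simp only [modelBracket, Prod.smul_fst, Prod.smul_snd, Derivation.map_smul, smul_sub, smul_mul_assoc,
      mul_smul_comm]

/-- `p ↦ p(L) x`. -/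
def evalAt {M : Type*} [AddCommGroup M] [Module ℂ M] (L : M ≃ₗ[ℂ] M) (x : M) :
    ℂ[T;T⁻¹] →ₗ[ℂ] M :=
  laurentLift fun n => (L ^ n) x

section eval

variable {M : Type*} [AddCommGroup M] [Module ℂ M] (L : M ≃ₗ[ℂ] M) (x : M)

theorem evalAt_T (n : ℤ) : evalAt L x (T n) = (L ^ n) x := laurentLift_T _ n

theorem evalAt_one : evalAt L x 1 = x := by rw [← T_zero, evalAt_T]; rfl

theorem evalAt_T_mul (n : ℤ) (p : ℂ[T;T⁻¹]) : evalAt L x (T n * p) = (L ^ n) (evalAt L x p) := by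
  induction p using laurent_induction with
  | add p q hp hq => rw [mul_add, map_add, hp, hq, map_add, map_add]
  | smul a p hp => rw [mul_smul_comm, map_smul, hp, map_smul, map_smul]
  | mono m => rw [← T_add, evalAt_T, evalAt_T, zpow_add]; rfl

end eval

theorem jetBracket_evalAt {H : Type*} [AddCommGroup H] [Module ℂ H] {L : H ≃ₗ[ℂ] H}
    {dL : H →ₗ[ℂ] H →ₗ[ℂ] H} (hL : ∀ f g, dL (L g) f - dL (L f) g = L (dL g f - dL f g))
    {x y : Jet H} {κ μ : ℂ} (hx : ∀ f, lieDer L dL x f = κ • L f)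
    (hy : ∀ f, lieDer L dL y f = μ • L f) (hxy : jetBracket x y = 0) (p q : ℂ[T;T⁻¹]) :
    jetBracket (evalAt (jetL L dL) x p) (evalAt (jetL L dL) y q) =
      (μ • evalAt (jetL L dL) x (euler p * q) - κ • evalAt (jetL L dL) y (p * euler q)).1 := by
  induction p using laurent_induction with
  | add p p' hp hp' =>
    simp only [map_add, LinearMap.add_apply, hp, hp', add_mul, Prod.fst_add, Prod.fst_sub,
      Prod.smul_fst]
    module
  | smul a p hp =>
    simp only [Derivation.map_smul, map_smul, LinearMap.smul_apply, hp, smul_mul_assoc, Prod.smul_fst, Prod.fst_sub]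
    module
  | mono n =>
    induction q using laurent_induction with
    | add q q' hq hq' =>
      simp only [map_add, hq, hq', mul_add, Prod.fst_add, Prod.fst_sub, Prod.smul_fst]
      module
    | smul a q hq =>
      simp only [Derivation.map_smul, map_smul, hq, mul_smul_comm, Prod.smul_fst, Prod.fst_sub]
      module
    | mono m =>
      rw [evalAt_T, evalAt_T, jetBracket_zpow_zpow hL hx hy hxy, euler_T, euler_T, mul_smul_comm,
        smul_mul_assoc, map_smul, map_smul, ← T_add, evalAt_T, evalAt_T]
      simp only [Prod.fst_sub, Prod.smul_fst, jetL_zpow_fst]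
      module

end

end IDNLS

/-! ### Holomorphic dependence on the potential along complex lines -/

namespace IDNLS

noncomputable section

open Metric

/-! ### Holomorphic families of sequences -/

/-- A holomorphic family of sequences on the disc of radius `δ`, uniformly rapidly decreasing, with
derivative `F'` at the centre. -/
structure RapidFamily (δ : ℝ) (F : ℂ → Sequence) (F' : Sequence) : Prop where
  diff : ∀ n, DifferentiableOn ℂ (fun t => F t n) (ball 0 δ)
  rapid : RapidOn (ball 0 δ) F
  deriv : ∀ n, HasDerivAt (fun t => F t n) (F' n) 0

/-- A holomorphic family of sequences on the disc of radius `δ`, uniformly bounded, with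
derivative `F'` at the centre. -/
structure BoundedFamily (δ : ℝ) (F : ℂ → Sequence) (F' : Sequence) : Prop where
  diff : ∀ n, DifferentiableOn ℂ (fun t => F t n) (ball 0 δ)
  bounded : BoundedOn (ball 0 δ) F
  deriv : ∀ n, HasDerivAt (fun t => F t n) (F' n) 0

variable {δ : ℝ} {F G : ℂ → Sequence} {F' G' : Sequence}

theorem RapidFamily.mono {δ' : ℝ} (hF : RapidFamily δ F F') (h : δ' ≤ δ) : RapidFamily δ' F F' :=
  ⟨fun n => (hF.diff n).mono (ball_subset_ball h), hF.rapid.mono (ball_subset_ball h), hF.deriv⟩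

theorem RapidFamily.toBounded (hF : RapidFamily δ F F') : BoundedFamily δ F F' :=
  ⟨hF.diff, hF.rapid.boundedOn, hF.deriv⟩

theorem RapidFamily.shift (j : ℤ) (hF : RapidFamily δ F F') :
    RapidFamily δ (fun t => shift j (F t)) (shift j F') :=
  ⟨fun n => hF.diff (n + j), hF.rapid.shift j, fun n => hF.deriv (n + j)⟩

theorem BoundedFamily.shift (j : ℤ) (hF : BoundedFamily δ F F') :
    BoundedFamily δ (fun t => IDNLS.shift j (F t)) (IDNLS.shift j F') :=
  ⟨fun n => hF.diff (n + j), hF.bounded.shift j, fun n => hF.deriv (n + j)⟩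

theorem RapidFamily.add (hF : RapidFamily δ F F') (hG : RapidFamily δ G G') :
    RapidFamily δ (fun t => F t + G t) (F' + G') :=
  ⟨fun n => (hF.diff n).add (hG.diff n), hF.rapid.add hG.rapid,
    fun n => (hF.deriv n).add (hG.deriv n)⟩

theorem RapidFamily.smul (a : ℂ) (hF : RapidFamily δ F F') :
    RapidFamily δ (fun t => a • F t) (a • F') :=
  ⟨fun n => (hF.diff n).const_mul a, hF.rapid.smul a, fun n => (hF.deriv n).const_mul a⟩

theorem RapidFamily.mul (hF : RapidFamily δ F F') (hG : BoundedFamily δ G G') :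
    RapidFamily δ (fun t => F t * G t) (F' * G 0 + F 0 * G') :=
  ⟨fun n => (hF.diff n).mul (hG.diff n), hF.rapid.mul_boundedOn hG.bounded,
    fun n => (hF.deriv n).mul (hG.deriv n)⟩

theorem RapidFamily.affine_mul (κ a : ℂ) (hF : RapidFamily δ F F') :
    RapidFamily δ (fun t n => (κ * n + a) * F t n) (fun n => (κ * n + a) * F' n) := by
  refine ⟨fun n => (hF.diff n).const_mul _, ?_, fun n => (hF.deriv n).const_mul _⟩
  refine ((hF.rapid.index_mul.smul κ).add (hF.rapid.smul a)).congr fun t _ => ?_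
  funext n
  simp only [Pi.add_apply, Pi.smul_apply, smul_eq_mul]
  ring

/-- By Weierstrass' theorem a dominated series of holomorphic functions may be differentiated term
by term. No bound on the derivatives is required, which is the reason for letting `t` be complex. -/
theorem RapidFamily.tsum (hδ : 0 < δ) (hF : RapidFamily δ F F') {e : ℕ → ℤ}
    (he : Function.Injective e) :
    DifferentiableOn ℂ (fun t => ∑' k, F t (e k)) (ball 0 δ) ∧
      HasDerivAt (fun t => ∑' k, F t (e k)) (∑' k, F' (e k)) 0 := by
  obtain ⟨C, h0, hC⟩ := hF.rapid.le_weight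
  have hu := (summable_weight.comp_injective he).mul_left C
  have hle : ∀ (k : ℕ) (t : ℂ), t ∈ ball (0 : ℂ) δ → ‖F t (e k)‖ ≤ C * weight (e k) :=
    fun k t ht => hC t ht (e k)
  have hd := Complex.differentiableOn_tsum_of_summable_norm hu (fun k => hF.diff (e k)) isOpen_ball
    hle
  refine ⟨hd, ?_⟩
  have h0 : (0 : ℂ) ∈ ball (0 : ℂ) δ := mem_ball_self hδ
  have hs := Complex.hasSum_deriv_of_summable_norm hu (fun k => hF.diff (e k)) isOpen_ball hle h0
  have := (hd.differentiableAt (isOpen_ball.mem_nhds h0)).hasDerivAt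
  rw [← hs.tsum_eq] at this
  simpa only [(hF.deriv _).deriv] using this

theorem RapidFamily.invDiff (c : ℝ) (hδ : 0 < δ) (hF : RapidFamily δ F F') :
    BoundedFamily δ (fun t => invDiff c (F t)) (invDiff c F') := by
  refine ⟨fun n => ?_, hF.rapid.invDiff c, fun n => ?_⟩
  · exact ((hF.tsum hδ (injective_left n)).1.const_mul _).sub
      ((hF.tsum hδ (injective_right n)).1.const_mul _)
  · exact ((hF.tsum hδ (injective_left n)).2.const_mul _).sub
      ((hF.tsum hδ (injective_right n)).2.const_mul _)

theorem BoundedFamily.neg (hF : BoundedFamily δ F F') :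
    BoundedFamily δ (fun t => -F t) (-F') := by
  refine ⟨fun n => (hF.diff n).neg, ?_, fun n => (hF.deriv n).neg⟩
  obtain ⟨C, h0, hC⟩ := hF.bounded
  exact ⟨C, h0, fun t ht n => by simpa using hC t ht n⟩

theorem BoundedFamily.add (hF : BoundedFamily δ F F') (hG : BoundedFamily δ G G') :
    BoundedFamily δ (fun t => F t + G t) (F' + G') := by
  refine ⟨fun n => (hF.diff n).add (hG.diff n), ?_, fun n => (hF.deriv n).add (hG.deriv n)⟩
  obtain ⟨C, h0, hC⟩ := hF.bounded
  obtain ⟨D, h1, hD⟩ := hG.bounded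
  exact ⟨C + D, add_nonneg h0 h1, fun t ht n =>
    (norm_add_le _ _).trans (add_le_add (hC t ht n) (hD t ht n))⟩

theorem RapidFamily.neg (hF : RapidFamily δ F F') : RapidFamily δ (fun t => -F t) (-F') := by
  simpa using hF.smul (-1)

/-! ### Lines of potentials -/

/-- On the disc of radius `δ` the line `u + t v` consists of admissible potentials, uniformly. -/
structure IsLine (δ : ℝ) (u v : VecSequence) : Prop where
  pos : 0 < δ
  mem : ∀ t ∈ ball (0 : ℂ) δ, u + t • v ∈ potentials
  inv : BoundedOn (ball (0 : ℂ) δ) (fun t n => (1 - (u + t • v).1 n * (u + t • v).2 n)⁻¹)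

variable {u v : VecSequence}

theorem IsLine.mono {δ' : ℝ} (h : IsLine δ u v) (h0 : 0 < δ') (h1 : δ' ≤ δ) : IsLine δ' u v :=
  ⟨h0, fun t ht => h.mem t (ball_subset_ball h1 ht), h.inv.mono (ball_subset_ball h1)⟩

theorem exists_isLine (hu : u ∈ potentials) (hv : v ∈ rapidVec) : ∃ δ, IsLine δ u v := by
  obtain ⟨M, hM⟩ := potentials_inv_bdd hu
  obtain ⟨A, hA⟩ := rapid_bdd (rapid_mul_rapid hu.1 hv.2)
  obtain ⟨B, hB⟩ := rapid_bdd (rapid_mul_rapid hv.1 hu.2.1)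
  obtain ⟨D, hD⟩ := rapid_bdd (rapid_mul_rapid hv.1 hv.2)
  have hA0 : 0 ≤ A := (norm_nonneg _).trans (hA 0)
  have hB0 : 0 ≤ B := (norm_nonneg _).trans (hB 0)
  have hD0 : 0 ≤ D := (norm_nonneg _).trans (hD 0)
  have hM0 : 0 < M := lt_of_lt_of_le (norm_pos_iff.mpr (inv_ne_zero (hu.2.2 0))) (hM 0)
  set N := A + B + D + 1 with hN
  have hN0 : 0 < N := by positivity
  -- `M` bounds the inverse of 1 - QR, so its modulus is at least 1/M. For |t| ≤ 1 its change along
  -- the line is at most |t|N, so δ ≤ 1/(2MN) leaves at least 1/(2M).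
  set δ := min 1 (1 / (2 * M * N)) with hδ
  have hδ0 : 0 < δ := lt_min one_pos (by positivity)
  have key : ∀ t ∈ ball (0 : ℂ) δ, ∀ n,
      1 / (2 * M) ≤ ‖1 - (u + t • v).1 n * (u + t • v).2 n‖ := fun t ht n => by
    rw [mem_ball_zero_iff] at ht
    have ht1 : ‖t‖ ≤ 1 := (ht.trans_le (min_le_left _ _)).le
    have ht2 : ‖t‖ ≤ 1 / (2 * M * N) := (ht.trans_le (min_le_right _ _)).le
    have h1 : 1 / M ≤ ‖1 - u.1 n * u.2 n‖ := by
      have := hM n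
      rw [norm_inv] at this
      rw [one_div]
      exact inv_le_of_inv_le₀ (norm_pos_iff.mpr (hu.2.2 n)) this
    have h2 : ‖u.1 n * v.2 n + v.1 n * u.2 n + t * (v.1 n * v.2 n)‖ ≤ N := by
      refine (norm_add₃_le).trans ?_
      rw [norm_mul t]
      have h3 : ‖t‖ * ‖v.1 n * v.2 n‖ ≤ 1 * D :=
        mul_le_mul ht1 (hD n) (norm_nonneg _) zero_le_one
      have h4 := hA n
      have h5 := hB n
      simp only [Pi.mul_apply] at h4 h5
      linarith
    have h3 : 1 - (u + t • v).1 n * (u + t • v).2 n =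
        (1 - u.1 n * u.2 n) - t * (u.1 n * v.2 n + v.1 n * u.2 n + t * (v.1 n * v.2 n)) := by
      simp only [Prod.fst_add, Prod.snd_add, Prod.smul_fst, Prod.smul_snd, Pi.add_apply,
        Pi.smul_apply, smul_eq_mul]
      ring
    have h4 : ‖t * (u.1 n * v.2 n + v.1 n * u.2 n + t * (v.1 n * v.2 n))‖ ≤ 1 / (2 * M) := by
      rw [norm_mul]
      calc _ ≤ 1 / (2 * M * N) * N := mul_le_mul ht2 h2 (norm_nonneg _) (by positivity)
        _ = 1 / (2 * M) := by field_simp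
    rw [h3]
    have h5 := norm_sub_norm_le (1 - u.1 n * u.2 n)
      (t * (u.1 n * v.2 n + v.1 n * u.2 n + t * (v.1 n * v.2 n)))
    have h6 : 1 / M = 1 / (2 * M) + 1 / (2 * M) := by field_simp; norm_num
    linarith
  have hpos : 0 < 1 / (2 * M) := by positivity
  refine ⟨δ, hδ0, fun t ht => ⟨rapid.add_mem hu.1 (rapid.smul_mem t hv.1),
    rapid.add_mem hu.2.1 (rapid.smul_mem t hv.2), fun n => ?_⟩, 2 * M, by positivity,
    fun t ht n => ?_⟩
  · exact norm_pos_iff.mp (hpos.trans_le (key t ht n))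
  · rw [norm_inv]
    refine inv_le_of_inv_le₀ (by positivity) ?_
    rw [← one_div]
    exact key t ht n

theorem line_family (f g : Sequence) (hf : f ∈ rapid) (hg : g ∈ rapid) :
    RapidFamily δ (fun t => f + t • g) g := by
  have h1 : ∀ n t, HasDerivAt (fun t : ℂ => (f + t • g) n) (g n) t := fun n t => by
    have := ((hasDerivAt_id t).mul_const (g n)).const_add (f n)
    simpa using this
  refine ⟨fun n t _ => (h1 n t).differentiableAt.differentiableWithinAt, ?_, fun n => h1 n 0⟩
  refine RapidOn.add (F := fun _ => f) (G := fun t : ℂ => t • g)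
    (RapidlyDecreasing.rapidOn hf) fun k => ?_
  obtain ⟨C, hC⟩ := hg k
  refine ⟨δ * C, fun t ht n => ?_⟩
  rw [mem_ball_zero_iff] at ht
  change |(n : ℝ)| ^ k * ‖t • g n‖ ≤ δ * C
  rw [norm_smul, mul_left_comm]
  exact mul_le_mul ht.le (hC n) (by positivity) ((norm_nonneg t).trans ht.le)

namespace IsLine

variable (h : IsLine δ u v) (hv : v ∈ rapidVec)

include h

theorem mem_potentials : u ∈ potentials := by
  simpa using h.mem 0 (mem_ball_self h.pos)

include hv

theorem fst_family : RapidFamily δ (fun t => (u + t • v).1) v.1 :=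
  line_family u.1 v.1 h.mem_potentials.1 hv.1

theorem snd_family : RapidFamily δ (fun t => (u + t • v).2) v.2 :=
  line_family u.2 v.2 h.mem_potentials.2.1 hv.2

theorem inv_family : BoundedFamily δ (fun t n => (1 - (u + t • v).1 n * (u + t • v).2 n)⁻¹)
    (fun n => (v.1 n * u.2 n + u.1 n * v.2 n) / (1 - u.1 n * u.2 n) ^ 2) := by
  have hp := (h.fst_family hv).mul (h.snd_family hv).toBounded
  refine ⟨fun n => ?_, h.inv, fun n => ?_⟩
  · exact ((hp.diff n).const_sub 1).inv fun t ht => (h.mem t ht).2.2 n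
  · have h1 := ((hp.deriv n).const_sub 1).inv (by simpa using h.mem_potentials.2.2 n)
    have h2 : (v.1 n * u.2 n + u.1 n * v.2 n) / (1 - u.1 n * u.2 n) ^ 2 =
        -(-(v.1 * (u + (0 : ℂ) • v).2 + (u + (0 : ℂ) • v).1 * v.2) n) /
          (1 - ((u + (0 : ℂ) • v).1 * (u + (0 : ℂ) • v).2) n) ^ 2 := by
      simp
    rw [h2]
    exact h1

variable {Y : ℂ → VecSequence} {Y' : VecSequence} (hY' : Y' ∈ rapidVec)
  (h1 : RapidFamily δ (fun t => (Y t).1) Y'.1) (h2 : RapidFamily δ (fun t => (Y t).2) Y'.2)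

include hY' h1 h2

omit hv hY' in
theorem value_rapid : Y 0 ∈ rapidVec :=
  ⟨h1.rapid.apply (mem_ball_self h.pos), h2.rapid.apply (mem_ball_self h.pos)⟩

theorem laxB_family (c : ℝ) : BoundedFamily δ (fun t => laxB c (u + t • v) (Y t))
    (dlaxB c u v (Y 0) + laxB c u Y') := by
  have hu := h.mem_potentials
  have hY := h.value_rapid h1 h2
  have hs := (((h.snd_family hv).mul h1.toBounded).add ((h.fst_family hv).mul h2.toBounded)).mul
    (h.inv_family hv)
  convert hs.invDiff c h.pos using 1
  · funext t
    rw [laxB, div_eq_mul_inv]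
    rfl
  · rw [dlaxB, laxB, ← invDiff_add c (dlaxB_rapid_source hu hv hY) (laxB_rapid_source hu hY')]
    congr 1
    funext n
    have hn := hu.2.2 n
    simp only [zero_smul, add_zero, Pi.add_apply, Pi.mul_apply, Pi.div_apply, Pi.sub_apply,
      Pi.one_apply]
    field_simp
    ring

theorem laxA_family (c : ℝ) : BoundedFamily δ (fun t => laxA c (u + t • v) (Y t))
    (dlaxA c u v (Y 0) + laxA c u Y') := by
  have hu := h.mem_potentials
  have hY := h.value_rapid h1 h2
  have hs := ((h.snd_family hv).mul (h1.shift 1).toBounded).add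
    ((h.fst_family hv).mul (h2.shift (-1)).toBounded)
  have hb := (((h.fst_family hv).mul ((h.snd_family hv).shift (-1)).toBounded).mul
    (h.laxB_family hv hY' h1 h2 c)).toBounded
  convert (hs.invDiff c h.pos).neg.add hb using 1
  · funext t n
    simp only [laxA, Pi.add_apply, Pi.mul_apply, Pi.neg_apply, shift, sub_eq_add_neg n]
  · have h3 : v.2 * shift 1 (Y 0).1 + (u + (0 : ℂ) • v).2 * shift 1 Y'.1 +
        (v.1 * shift (-1) (Y 0).2 + (u + (0 : ℂ) • v).1 * shift (-1) Y'.2) =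
        (v.2 * shift 1 (Y 0).1 + v.1 * shift (-1) (Y 0).2) +
          (u.2 * shift 1 Y'.1 + u.1 * shift (-1) Y'.2) := by
      rw [zero_smul, add_zero]
      ring
    rw [h3, invDiff_add c (dlaxA_rapid_source hv hY) (laxA_rapid_source hu hY')]
    funext n
    simp only [dlaxA, laxA, zero_smul, add_zero, Pi.add_apply, Pi.mul_apply, Pi.neg_apply, shift,
      sub_eq_add_neg n]
    ring

theorem laxP_family (c : ℝ) : RapidFamily δ (fun t => laxP c (u + t • v) (Y t))
    (dlaxP c u v (Y 0) + laxP c u Y') := by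
  convert h1.add ((h.fst_family hv).mul (h.laxB_family hv hY' h1 h2 c)).neg using 1
  · funext t n
    simp [laxP, sub_eq_add_neg]
  · funext n
    simp only [dlaxP, laxP, zero_smul, add_zero, Pi.add_apply, Pi.mul_apply, Pi.neg_apply]
    ring

theorem laxQ_family (c : ℝ) : RapidFamily δ (fun t => laxQ c (u + t • v) (Y t))
    (dlaxQ c u v (Y 0) + laxQ c u Y') := by
  convert (h2.shift (-1)).neg.add
    (((h.snd_family hv).shift (-1)).mul (h.laxB_family hv hY' h1 h2 c)).neg using 1
  · funext t n
    simp [laxQ, sub_eq_add_neg, shift]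
  · funext n
    simp only [dlaxQ, laxQ, zero_smul, add_zero, Pi.add_apply, Pi.mul_apply, Pi.neg_apply, shift,
      sub_eq_add_neg n]
    ring

theorem recursionL_family_fst (c : ℝ) :
    RapidFamily δ (fun t => (recursionL c (u + t • v) (Y t)).1)
      (dRecursionL c u v (Y 0) + recursionL c u Y').1 := by
  convert ((h.fst_family hv).mul ((h.laxA_family hv hY' h1 h2 c).shift 1)).add
    ((h.laxP_family hv hY' h1 h2 c).shift 1) using 1
  · funext t n
    simp only [recursionL_fst, Pi.add_apply, Pi.mul_apply, shift]
  · funext n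
    simp only [Prod.fst_add, dRecursionL_fst, recursionL_fst, zero_smul, add_zero, Pi.add_apply,
      Pi.mul_apply, shift]
    ring

theorem recursionL_family_snd (c : ℝ) :
    RapidFamily δ (fun t => (recursionL c (u + t • v) (Y t)).2)
      (dRecursionL c u v (Y 0) + recursionL c u Y').2 := by
  convert ((h.snd_family hv).mul (h.laxA_family hv hY' h1 h2 c)).neg.add
    (h.laxQ_family hv hY' h1 h2 c).neg using 1
  · funext t n
    simp only [recursionL_snd, Pi.add_apply, Pi.mul_apply, Pi.neg_apply]
    ring
  · funext n
    simp only [Prod.snd_add, dRecursionL_snd, recursionL_snd, zero_smul, add_zero, Pi.add_apply,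
      Pi.mul_apply, Pi.neg_apply]
    ring

end IsLine

end

end IDNLS

/-! ### Smoothness of the flows and the bracket homomorphism -/

namespace IDNLS

noncomputable section

open Metric LaurentPolynomial

/-! ### Smooth fields of jets -/

/-- The field of jets `J` consists of a vector field which is holomorphic along complex lines, and
of its derivative. -/
def IsSmooth (J : potentials → Jet rapidVec) : Prop :=
  ∀ (u : potentials) (v : rapidVec), ∃ (δ : ℝ) (Y : ℂ → VecSequence), IsLine δ u v ∧
    (∀ t ∈ ball (0 : ℂ) δ, ∀ h : (u : VecSequence) + t • (v : VecSequence) ∈ potentials,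
      Y t = (J ⟨_, h⟩).1) ∧
    RapidFamily δ (fun t => (Y t).1) ((J u).2 v : VecSequence).1 ∧
    RapidFamily δ (fun t => (Y t).2) ((J u).2 v : VecSequence).2

theorem eq_at_zero {J : potentials → Jet rapidVec} {u : potentials} {v : rapidVec} {δ : ℝ}
    {Y : ℂ → VecSequence} (h : IsLine δ u v)
    (hY : ∀ t ∈ ball (0 : ℂ) δ, ∀ h : (u : VecSequence) + t • (v : VecSequence) ∈ potentials,
      Y t = (J ⟨_, h⟩).1) : Y 0 = (J u).1 := by
  have h0 := mem_ball_self (x := (0 : ℂ)) h.pos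
  rw [hY 0 h0 (h.mem 0 h0)]
  congr 3
  refine Subtype.ext ?_
  simp

theorem IsSmooth.add {J J' : potentials → Jet rapidVec} (hJ : IsSmooth J) (hJ' : IsSmooth J') :
    IsSmooth (fun u => J u + J' u) := fun u v => by
  obtain ⟨δ, Y, hl, hY, h1, h2⟩ := hJ u v
  obtain ⟨δ', Y', hl', hY', h1', h2'⟩ := hJ' u v
  have hle := min_le_left δ δ'
  have hle' := min_le_right δ δ'
  refine ⟨min δ δ', fun t => Y t + Y' t, hl.mono (lt_min hl.pos hl'.pos) hle, fun t ht h => ?_,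
    (h1.mono hle).add (h1'.mono hle'), (h2.mono hle).add (h2'.mono hle')⟩
  beta_reduce
  rw [hY t (ball_subset_ball hle ht) h, hY' t (ball_subset_ball hle' ht) h]
  rfl

theorem IsSmooth.smul {J : potentials → Jet rapidVec} (a : ℂ) (hJ : IsSmooth J) :
    IsSmooth (fun u => a • J u) := fun u v => by
  obtain ⟨δ, Y, hl, hY, h1, h2⟩ := hJ u v
  refine ⟨δ, fun t => a • Y t, hl, fun t ht h => ?_, h1.smul a, h2.smul a⟩
  beta_reduce
  rw [hY t ht h]
  rfl

theorem IsSmooth.jetL (c : ℝ) {J : potentials → Jet rapidVec} (hJ : IsSmooth J) :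
    IsSmooth (fun u => IDNLS.jetL (recL c u) (dRecL c u) (J u)) := fun u v => by
  obtain ⟨δ, Y, hl, hY, h1, h2⟩ := hJ u v
  refine ⟨δ, fun t => recursionL c (u + t • v) (Y t), hl, fun t ht h => ?_, ?_, ?_⟩
  · beta_reduce
    rw [hY t ht h]
    rfl
  · have := hl.recursionL_family_fst v.2 ((J u).2 v).2 h1 h2 c
    rwa [eq_at_zero hl hY] at this
  · have := hl.recursionL_family_snd v.2 ((J u).2 v).2 h1 h2 c
    rwa [eq_at_zero hl hY] at this

theorem IsLine.swap {δ : ℝ} {u v : VecSequence} (h : IsLine δ u v) : IsLine δ u.swap v.swap := by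
  refine ⟨h.pos, fun t ht => swap_potentials (h.mem t ht), ?_⟩
  obtain ⟨C, h0, hC⟩ := h.inv
  refine ⟨C, h0, fun t ht n => ?_⟩
  have := hC t ht n
  beta_reduce at this
  rwa [mul_comm] at this

/-- Holomorphy of L⁻¹Y follows from that of `L` by exchanging components. The value of the
derivative is not computed directly: it is forced by differentiating L Z = Y. -/
theorem IsSmooth.jetL_symm (c : ℝ) {J : potentials → Jet rapidVec} (hJ : IsSmooth J) :
    IsSmooth (fun u => (IDNLS.jetL (recL c u) (dRecL c u)).symm (J u)) := fun u v => by
  obtain ⟨δ, Y, hl, hY, h1, h2⟩ := hJ u v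
  set Y' := (J u).2 v with hY'
  have hYr := hl.value_rapid h1 h2
  have hs1 := hl.swap.recursionL_family_fst v.2.symm (Y := fun t => (Y t).swap)
    (Y' := (Y' : VecSequence).swap) Y'.2.symm h2 h1 c
  have hs2 := hl.swap.recursionL_family_snd v.2.symm (Y := fun t => (Y t).swap)
    (Y' := (Y' : VecSequence).swap) Y'.2.symm h2 h1 c
  set Z : ℂ → VecSequence := fun t => recursionLInv c (u + t • v) (Y t) with hZ
  set ζ : rapidVec := ⟨(dRecursionL c (u : VecSequence).swap (v : VecSequence).swap (Y 0).swap +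
    recursionL c (u : VecSequence).swap (Y' : VecSequence).swap).swap,
      (rapidVec.add_mem (dRecursionL_rapid (swap_potentials u.2) v.2.symm hYr.symm)
        (recursionL_rapid (swap_potentials u.2) Y'.2.symm)).symm⟩ with hζ
  have hZeq : ∀ t, Z t =
      (recursionL c ((u : VecSequence).swap + t • (v : VecSequence).swap) (Y t).swap).swap :=
    fun t => recursionLInv_eq_swap
  have z1 : RapidFamily δ (fun t => (Z t).1) (ζ : VecSequence).1 := by
    simp only [hZeq]
    exact hs2
  have z2 : RapidFamily δ (fun t => (Z t).2) (ζ : VecSequence).2 := by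
    simp only [hZeq]
    exact hs1
  have hYZ : ∀ t ∈ ball (0 : ℂ) δ, recursionL c (u + t • v) (Z t) = Y t := fun t ht =>
    recursionL_recursionLInv (hl.mem t ht) ⟨h1.rapid.apply ht, h2.rapid.apply ht⟩
  have hnhds := isOpen_ball.mem_nhds (mem_ball_self (x := (0 : ℂ)) hl.pos)
  have hZ0 : Z 0 = ((recL c u).symm (J u).1 : VecSequence) := by
    simp only [hZ, zero_smul, add_zero, eq_at_zero hl hY]
    rfl
  -- The product rule for L Z = Y at t = 0; uniqueness of derivatives gives a linear equation that
  -- determines `ζ`.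
  have e : dRecL c u v ((recL c u).symm (J u).1) + recL c u ζ = Y' := by
    refine Subtype.ext (Prod.ext (funext fun n => ?_) (funext fun n => ?_))
    · have h3 := (hl.recursionL_family_fst v.2 ζ.2 z1 z2 c).deriv n
      rw [hZ0] at h3
      exact h3.unique ((h1.deriv n).congr_of_eventuallyEq
        (Filter.eventuallyEq_of_mem hnhds fun t ht => by simp only [hYZ t ht]))
    · have h3 := (hl.recursionL_family_snd v.2 ζ.2 z1 z2 c).deriv n
      rw [hZ0] at h3
      exact h3.unique ((h2.deriv n).congr_of_eventuallyEq
        (Filter.eventuallyEq_of_mem hnhds fun t ht => by simp only [hYZ t ht]))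
  have hζ' : ((IDNLS.jetL (recL c u) (dRecL c u)).symm (J u)).2 v = ζ := by
    change (recL c u).symm (Y' - dRecL c u v ((recL c u).symm (J u).1)) = ζ
    rw [LinearEquiv.symm_apply_eq, ← e, add_sub_cancel_left]
  refine ⟨δ, Z, hl, fun t ht h => ?_, ?_, ?_⟩
  · simp only [hZ, hY t ht h]
    rfl
  · rw [hζ']
    exact z1
  · rw [hζ']
    exact z2

theorem IsSmooth.evalAt (c : ℝ) {J : potentials → Jet rapidVec} (hJ : IsSmooth J)
    (p : ℂ[T;T⁻¹]) : IsSmooth (fun u => evalAt (IDNLS.jetL (recL c u) (dRecL c u)) (J u) p) := by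
  induction p using laurent_induction with
  | add p q hp hq => simpa only [map_add] using hp.add hq
  | smul a p hp => simpa only [map_smul] using hp.smul a
  | mono n =>
    simp only [evalAt_T]
    induction n using Int.induction_on with
    | zero => simpa using hJ
    | succ n ih =>
      simp only [add_comm _ (1 : ℤ), zpow_one_add, LinearEquiv.mul_apply]
      exact ih.jetL c
    | pred n ih =>
      simp only [sub_eq_neg_add _ (1 : ℤ), zpow_add, zpow_neg_one, LinearEquiv.mul_apply]
      exact ih.jetL_symm c

/-- The jet of the vector field `(κ n + a) (Q, -R)`. -/
def twistJet (κ a : ℂ) (u : potentials) : Jet rapidVec := (twist κ a (potentialVec u), twist κ a)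

theorem twistJet_smooth (κ a : ℂ) : IsSmooth (twistJet κ a) := fun u v => by
  obtain ⟨δ, hl⟩ := exists_isLine u.2 v.2
  refine ⟨δ, fun t => (fun n => (κ * n + a) * (u + t • v : VecSequence).1 n,
    fun n => -((κ * n + a) * (u + t • v : VecSequence).2 n)), hl, fun t ht h => rfl, ?_, ?_⟩
  · exact (hl.fst_family v.2).affine_mul κ a
  · exact ((hl.snd_family v.2).affine_mul κ a).neg

theorem lieDer_twistJet (c : ℝ) (κ a : ℂ) (u : potentials) (f : rapidVec) :
    lieDer (recL c u) (dRecL c u) (twistJet κ a u) f = κ • recL c u f := by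
  rw [lieDer_apply, twistJet, dRecL_twist]
  abel

theorem jetBracket_twistJet (κ a κ' a' : ℂ) (u : potentials) :
    jetBracket (twistJet κ a u) (twistJet κ' a' u) = 0 := by
  refine Subtype.ext (Prod.ext (funext fun n => ?_) (funext fun n => ?_))
  · change (κ * n + a) * ((κ' * n + a') * u.1.1 n) - (κ' * n + a') * ((κ * n + a) * u.1.1 n) = 0
    ring
  · change -((κ * n + a) * -((κ' * n + a') * u.1.2 n)) -
      -((κ' * n + a') * -((κ * n + a) * u.1.2 n)) = 0
    ring

/-- The jet of the vector field `p(L) K + q(L) σ` with `K = (Q, -R)` and `σ = (n + 1/2) (Q, -R)`. -/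
def fieldJet (c : ℝ) (u : potentials) : Model →ₗ[ℂ] Jet rapidVec :=
  (evalAt (jetL (recL c u) (dRecL c u)) (twistJet 0 1 u)).coprod
    (evalAt (jetL (recL c u) (dRecL c u)) (twistJet 1 (1 / 2) u))

theorem fieldJet_apply (c : ℝ) (u : potentials) (w : Model) :
    fieldJet c u w = evalAt (jetL (recL c u) (dRecL c u)) (twistJet 0 1 u) w.1 +
      evalAt (jetL (recL c u) (dRecL c u)) (twistJet 1 (1 / 2) u) w.2 := rfl

theorem fieldJet_smooth (c : ℝ) (w : Model) : IsSmooth (fun u => fieldJet c u w) := by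
  simp only [fieldJet_apply]
  exact ((twistJet_smooth 0 1).evalAt c w.1).add ((twistJet_smooth 1 (1 / 2)).evalAt c w.2)

/-- The scaling factors are 0 for K and 1 for σ. Hence the K-K bracket drops out, only the factor of
K is differentiated in a mixed bracket, and both factors are differentiated in a σ-σ bracket. -/
theorem jetBracket_fieldJet (c : ℝ) (u : potentials) (w w' : Model) :
    jetBracket (fieldJet c u w) (fieldJet c u w') = (fieldJet c u (modelBracket w w')).1 := by
  have hL := recL_hereditary c u
  have hx := lieDer_twistJet c 0 1 u
  have hy := lieDer_twistJet c 1 (1 / 2) u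
  simp only [fieldJet_apply, map_add, LinearMap.add_apply]
  rw [jetBracket_evalAt hL hx hx (jetBracket_twistJet _ _ _ _ u),
    jetBracket_evalAt hL hx hy (jetBracket_twistJet _ _ _ _ u),
    jetBracket_evalAt hL hy hx (jetBracket_twistJet _ _ _ _ u),
    jetBracket_evalAt hL hy hy (jetBracket_twistJet _ _ _ _ u)]
  simp only [modelBracket, map_sub, zero_smul, one_smul, sub_zero, zero_sub, Prod.fst_add,
    Prod.fst_sub, Prod.fst_zero, mul_comm w.1, mul_comm w.2]
  abel

end

end IDNLS

/-! ### Reduction to a single potential -/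

namespace IDNLS

noncomputable section

open Metric LaurentPolynomial ComplexConjugate

/-! ### The real structure -/

/-- The antilinear involution whose fixed points are tangent to the reduced potentials. -/
def conjSwap (ε : ℝ) (v : VecSequence) : VecSequence :=
  (fun n => -(ε : ℂ) * conj (v.2 n), fun n => -(ε : ℂ) * conj (v.1 n))

/-- Here it matters that the constant of summation is real. -/
theorem invDiff_conj (c : ℝ) (f : Sequence) :
    invDiff c (fun n => conj (f n)) = fun n => conj (invDiff c f n) := by
  funext n
  simp only [invDiff, map_sub, map_mul, map_one, Complex.conj_ofReal, Complex.conj_tsum]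

theorem conjSwap_add (ε : ℝ) (v w : VecSequence) :
    conjSwap ε (v + w) = conjSwap ε v + conjSwap ε w := by
  refine Prod.ext (funext fun n => ?_) (funext fun n => ?_) <;>
  · simp only [conjSwap, Prod.fst_add, Prod.snd_add, Pi.add_apply, map_add]
    ring

theorem conjSwap_smul (ε : ℝ) (a : ℂ) (v : VecSequence) :
    conjSwap ε (a • v) = conj a • conjSwap ε v := by
  refine Prod.ext (funext fun n => ?_) (funext fun n => ?_) <;>
  · simp only [conjSwap, Prod.smul_fst, Prod.smul_snd, Pi.smul_apply, smul_eq_mul, map_mul]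
    ring

theorem conjSwap_sub (ε : ℝ) (v w : VecSequence) :
    conjSwap ε (v - w) = conjSwap ε v - conjSwap ε w := by
  have h := conjSwap_add ε v ((-1 : ℂ) • w)
  rw [conjSwap_smul] at h
  simpa [sub_eq_add_neg] using h

theorem conjSwap_swap (ε : ℝ) (v : VecSequence) :
    conjSwap ε v.swap = (conjSwap ε v).swap := rfl

theorem recursionLInv_smul (c : ℝ) (u v : VecSequence) (a : ℂ) :
    recursionLInv c u (a • v) = a • recursionLInv c u v := by
  rw [recursionLInv_eq_swap, recursionLInv_eq_swap]
  exact congrArg Prod.swap (recursionL_smul (f := v.swap) a)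

theorem iterate_recursionAKNS_smul (c : ℝ) (u v : VecSequence) (a : ℂ) (m : ℕ) :
    (recursionAKNS c u)^[m] (a • v) = a • (recursionAKNS c u)^[m] v := by
  have h : ∀ w, recursionAKNS c u (a • w) = a • recursionAKNS c u w := fun w => by
    rw [recursionAKNS, recursionAKNS, recursionL_smul, recursionLInv_smul]
    module
  induction m generalizing v with
  | zero => rfl
  | succ m ih => rw [Function.iterate_succ_apply, Function.iterate_succ_apply, h, ih]

section realPotential

variable {c ε : ℝ} {u : VecSequence} (hu : conjSwap ε u = u)

include hu

/-- On a reduced potential, conjugation exchanges `Q` and `R` up to -ε, and `L⁻¹` is `L` with these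
roles exchanged. Consequently `L - 2 + L⁻¹` commutes with the involution while `L - L⁻¹`
anticommutes with it. -/
theorem recursionLInv_conjSwap (v : VecSequence) :
    recursionLInv c u (conjSwap ε v) = conjSwap ε (recursionL c u v) := by
  have h1 : ∀ n, -(ε : ℂ) * conj (u.2 n) = u.1 n := fun n => congrFun (congrArg Prod.fst hu) n
  have h2 : ∀ n, -(ε : ℂ) * conj (u.1 n) = u.2 n := fun n => congrFun (congrArg Prod.snd hu) n
  have g1 : ∀ n, conj (u.2 n) = -(ε : ℂ) * u.1 n := fun n => by
    rw [← h2 n]; simp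
  have g2 : ∀ n, conj (u.1 n) = -(ε : ℂ) * u.2 n := fun n => by
    rw [← h1 n]; simp
  have g3 : ∀ n, conj (u.1 n) * conj (u.2 n) = u.1 n * u.2 n := fun n => by
    rw [g2, ← h1 n]; ring
  have ha : u.2 * shift (-1) (conjSwap ε v).1 + u.1 * shift 1 (conjSwap ε v).2 =
      fun n => conj ((u.2 * shift 1 v.1 + u.1 * shift (-1) v.2) n) := by
    funext n
    simp only [Pi.add_apply, Pi.mul_apply, shift, conjSwap, map_add, map_mul, g1, g2]
    ring
  have hb : (u.2 * (conjSwap ε v).1 + u.1 * (conjSwap ε v).2) / (1 - u.1 * u.2) =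
      fun n => conj (((u.2 * v.1 + u.1 * v.2) / (1 - u.1 * u.2)) n) := by
    funext n
    simp only [Pi.add_apply, Pi.mul_apply, Pi.div_apply, Pi.sub_apply, Pi.one_apply, conjSwap,
      map_add, map_mul, map_div₀, map_sub, map_one, g3]
    rw [g1, g2]
    ring
  simp only [recursionLInv, recursionL, ha, hb, invDiff_conj]
  generalize invDiff c (u.2 * shift 1 v.1 + u.1 * shift (-1) v.2) = a
  generalize invDiff c ((u.2 * v.1 + u.1 * v.2) / (1 - u.1 * u.2)) = b
  refine Prod.ext (funext fun n => ?_) (funext fun n => ?_)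
  · simp only [Pi.add_apply, Pi.mul_apply, Pi.sub_apply, Pi.one_apply, conjSwap, shift, map_add,
      map_mul, map_sub, map_one, g3]
    rw [← h1 n, ← h1 (n + -1)]
    ring
  · simp only [Pi.mul_apply, Pi.sub_apply, Pi.one_apply, conjSwap, shift,
      map_mul, map_sub, map_one, g3]
    rw [← h2 n, ← h2 (n + 1)]
    ring

theorem recursionL_conjSwap (v : VecSequence) :
    recursionL c u (conjSwap ε v) = conjSwap ε (recursionLInv c u v) := by
  have h := recursionLInv_conjSwap (c := c) (u := u.swap) (ε := ε)
    (by rw [conjSwap_swap, hu]) v.swap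
  rw [recursionLInv_eq_swap, conjSwap_swap, Prod.swap_swap, Prod.swap_swap] at h
  rw [recursionLInv_eq_swap, conjSwap_swap, ← h, Prod.swap_swap]

theorem recursionAKNS_conjSwap (v : VecSequence) :
    recursionAKNS c u (conjSwap ε v) = conjSwap ε (recursionAKNS c u v) := by
  rw [recursionAKNS, recursionAKNS, conjSwap_add, conjSwap_sub, conjSwap_smul,
    recursionL_conjSwap hu, recursionLInv_conjSwap hu, Complex.conj_ofNat]
  abel

theorem conjSwap_iterate_recursionAKNS (m : ℕ) (v : VecSequence) :
    conjSwap ε ((recursionAKNS c u)^[m] v) = (recursionAKNS c u)^[m] (conjSwap ε v) := by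
  induction m generalizing v with
  | zero => rfl
  | succ m ih =>
    rw [Function.iterate_succ_apply, Function.iterate_succ_apply, ih, recursionAKNS_conjSwap hu]

end realPotential

/-! ### The flows in the model -/

/-- The Laurent polynomial of `𝓛 = L - 2 I + L⁻¹`. -/
def polyAKNS : ℂ[T;T⁻¹] := T 1 - (2 : ℂ) • 1 + T (-1)

/-- The Laurent polynomials `1` and `(1/2) (L - L⁻¹)` of the two seeds. -/
def polySeed (j : Fin 2) : ℂ[T;T⁻¹] := if j = 0 then 1 else (1 / 2 : ℂ) • (T 1 - T (-1))

theorem evalAt_AKNS_mul {c : ℝ} {u : potentials} {X : Jet rapidVec} (p : ℂ[T;T⁻¹]) :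
    ((evalAt (jetL (recL c u) (dRecL c u)) X (polyAKNS * p)).1 : VecSequence) =
      recursionAKNS c u (evalAt (jetL (recL c u) (dRecL c u)) X p).1 := by
  rw [polyAKNS, add_mul, sub_mul, smul_mul_assoc, one_mul, map_add, map_sub, map_smul, evalAt_T_mul,
    evalAt_T_mul, zpow_one, zpow_neg_one]
  rfl

theorem evalAt_AKNS_pow_mul {c : ℝ} {u : potentials} {X : Jet rapidVec} (m : ℕ) (p : ℂ[T;T⁻¹]) :
    ((evalAt (jetL (recL c u) (dRecL c u)) X (polyAKNS ^ m * p)).1 : VecSequence) =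
      (recursionAKNS c u)^[m] (evalAt (jetL (recL c u) (dRecL c u)) X p).1 := by
  induction m with
  | zero => rw [pow_zero, one_mul]; rfl
  | succ m ih => rw [pow_succ', mul_assoc, evalAt_AKNS_mul, ih, Function.iterate_succ_apply']

theorem evalAt_seed_one {c : ℝ} {u : potentials} {X : Jet rapidVec} :
    ((evalAt (jetL (recL c u) (dRecL c u)) X ((1 / 2 : ℂ) • (T 1 - T (-1)))).1 : VecSequence) =
      (1 / 2 : ℂ) • (recursionL c u X.1 - recursionLInv c u X.1) := by
  rw [map_smul, map_sub, evalAt_T, evalAt_T, zpow_one, zpow_neg_one]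
  rfl

theorem evalAt_isoSeed (c : ℝ) (u : potentials) (j : Fin 2) :
    ((evalAt (jetL (recL c u) (dRecL c u)) (twistJet 0 1 u) (polySeed j)).1 : VecSequence) =
      isoSeed c j u := by
  have h : ((twistJet 0 1 u).1 : VecSequence) = (u.1.1, -u.1.2) := by
    refine Prod.ext (funext fun n => ?_) (funext fun n => ?_) <;>
      simp [twistJet, twist, potentialVec]
  fin_cases j
  · simp only [polySeed, isoSeed, Fin.zero_eta, if_true, evalAt_one, h]
  · simp only [polySeed, isoSeed, Fin.mk_one, one_ne_zero, if_false, evalAt_seed_one, h]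

theorem evalAt_nonisoSeed (c : ℝ) (u : potentials) (j : Fin 2) :
    ((evalAt (jetL (recL c u) (dRecL c u)) (twistJet 1 (1 / 2) u) (polySeed j)).1 : VecSequence) =
      nonisoSeed c j u := by
  set s : VecSequence := (fun n => (2 * (n : ℂ) + 1) * u.1.1 n,
    fun n => -((2 * (n : ℂ) + 1) * u.1.2 n)) with hs
  have h : ((twistJet 1 (1 / 2) u).1 : VecSequence) = (1 / 2 : ℂ) • s := by
    refine Prod.ext (funext fun n => ?_) (funext fun n => ?_) <;>
    · simp only [twistJet, twist, potentialVec, LinearMap.coe_mk, AddHom.coe_mk, hs, Prod.smul_mk,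
        Pi.smul_apply, smul_eq_mul]
      ring
  fin_cases j
  · simp only [polySeed, nonisoSeed, Fin.zero_eta, if_true, evalAt_one, h, hs]
  · simp only [polySeed, nonisoSeed, Fin.mk_one, one_ne_zero, if_false, evalAt_seed_one, h,
      recursionL_smul, recursionLInv_smul, ← smul_sub, smul_smul, ← hs]
    norm_num

/-- The isospectral flows in the model. -/
def modelIso (j : Fin 2) (m : ℕ) : Model := (polyAKNS ^ m * polySeed j, 0)

/-- The non-isospectral flows in the model. -/
def modelNoniso (j : Fin 2) (s : ℕ) : Model := (0, polyAKNS ^ s * polySeed j)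

theorem fieldJet_modelIso (c : ℝ) (u : potentials) (j : Fin 2) (m : ℕ) :
    ((fieldJet c u (modelIso j m)).1 : VecSequence) =
      (recursionAKNS c u)^[m] (isoSeed c j u) := by
  rw [fieldJet_apply, modelIso, map_zero, add_zero, evalAt_AKNS_pow_mul, evalAt_isoSeed]

theorem fieldJet_modelNoniso (c : ℝ) (u : potentials) (j : Fin 2) (s : ℕ) :
    ((fieldJet c u (modelNoniso j s)).1 : VecSequence) =
      (recursionAKNS c u)^[s] (nonisoSeed c j u) := by
  rw [fieldJet_apply, modelNoniso, map_zero, zero_add, evalAt_AKNS_pow_mul, evalAt_nonisoSeed]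

section reduction

variable {ε : ℝ}

theorem conjSwap_reduced (hε : ε = 1 ∨ ε = -1) (Q : Sequence) :
    conjSwap ε (reduced ε Q) = reduced ε Q := by
  have h : (ε : ℂ) * ε = 1 := by rcases hε with rfl | rfl <;> simp
  refine Prod.ext (funext fun n => ?_) rfl
  simp only [conjSwap, reduced, map_mul, map_neg, Complex.conj_ofReal, Complex.conj_conj]
  linear_combination Q n * h

theorem conj_rapid {f : Sequence} (hf : f ∈ rapid) (a : ℂ) :
    (fun n => a * conj (f n) : Sequence) ∈ rapid := by
  refine rapid.smul_mem a (x := fun n => conj (f n)) fun k => ?_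
  simpa using hf k

theorem reduced_rapid {g : Sequence} (hg : g ∈ rapid) : reduced ε g ∈ rapidVec :=
  ⟨hg, conj_rapid hg _⟩

theorem reduced_mem_potentials_iff (Q : Sequence) :
    reduced ε Q ∈ potentials ↔ Q ∈ phaseSpace ε := by
  have h : ∀ n, 1 - Q n * (-(ε : ℂ) * conj (Q n)) = ((1 + ε * ‖Q n‖ ^ 2 : ℝ) : ℂ) := fun n => by
    have := Complex.mul_conj' (Q n)
    push_cast
    linear_combination (ε : ℂ) * this
  constructor
  · refine fun hQ => ⟨hQ.1, fun n h0 => hQ.2.2 n ?_⟩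
    exact (h n).trans (by rw [h0, Complex.ofReal_zero])
  · refine fun hQ => ⟨hQ.1, (reduced_rapid hQ.1).2, fun n h0 => hQ.2 n ?_⟩
    exact Complex.ofReal_eq_zero.mp ((h n).symm.trans h0)

/-- The complex potential of a scalar potential. -/
def complexify (Q : phaseSpace ε) : potentials :=
  ⟨reduced ε Q, (reduced_mem_potentials_iff _).mpr Q.2⟩

/-- The scalar flow of an element of the model. -/
def scalarFlow (c ε : ℝ) : Model →ₗ[ℂ] ScalarFlow ε where
  toFun w Q := ((fieldJet c (complexify Q) w).1 : VecSequence).1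
  map_add' w w' := by
    funext Q
    rw [map_add]
    rfl
  map_smul' a w := by
    funext Q
    rw [map_smul]
    rfl

theorem scalarFlow_apply (c : ℝ) (w : Model) (Q : phaseSpace ε) :
    scalarFlow c ε w Q = ((fieldJet c (complexify Q) w).1 : VecSequence).1 := rfl

theorem scalarFlow_modelIso (c : ℝ) (j : Fin 2) (m : ℕ) :
    scalarFlow c ε (modelIso j m) = isoFlow c ε j m := by
  funext Q
  rw [scalarFlow_apply, fieldJet_modelIso]
  rfl

theorem scalarFlow_modelNoniso (c : ℝ) (j : Fin 2) (s : ℕ) :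
    scalarFlow c ε (modelNoniso j s) = nonisoFlow c ε j s := by
  funext Q
  rw [scalarFlow_apply, fieldJet_modelNoniso]
  rfl

/-- R = -εQ* is real linear in `Q`, so a real line of scalar potentials is the real part of a
complex line of pairs, and the holomorphic derivative restricts to it. The default value in
`alongLine` is not met for small `t`. -/
theorem hasDerivAt_alongLine (c : ℝ) (w : Model) (Q : phaseSpace ε) {g : Sequence} (hg : g ∈ rapid)
    (n : ℤ) : HasDerivAt (alongLine (scalarFlow c ε w) Q g n)
      (((fieldJet c (complexify Q) w).2 ⟨reduced ε g, reduced_rapid hg⟩ : VecSequence).1 n) 0 := by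
  obtain ⟨δ, Y, hl, hY, h1, -⟩ :=
    fieldJet_smooth c w (complexify Q) ⟨reduced ε g, reduced_rapid hg⟩
  have hd := HasDerivAt.comp_ofReal (z := 0) (by simpa using h1.deriv n)
  refine hd.congr_of_eventuallyEq ?_
  refine Filter.eventuallyEq_of_mem (isOpen_ball.mem_nhds (mem_ball_self (x := (0 : ℝ)) hl.pos))
    fun t ht => ?_
  have ht' : (t : ℂ) ∈ ball (0 : ℂ) δ := by
    rw [mem_ball_zero_iff] at ht ⊢
    simpa using ht
  have hline : reduced ε ((Q : Sequence) + t • g) =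
      (complexify Q : VecSequence) + (t : ℂ) • reduced ε g := by
    refine Prod.ext (funext fun n => ?_) (funext fun n => ?_)
    · simp [reduced, complexify]
    · simp only [reduced, complexify, Prod.snd_add, Prod.smul_snd, Pi.add_apply, Pi.smul_apply,
        Complex.real_smul, map_add, map_mul, Complex.conj_ofReal, smul_eq_mul]
      ring
  have hmem := hl.mem t ht'
  have hQ : (Q : Sequence) + t • g ∈ phaseSpace ε := by
    rw [← reduced_mem_potentials_iff, hline]
    exact hmem
  have hval := hY t ht' hmem
  rw [alongLine, dif_pos hQ, hval, scalarFlow_apply]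
  have : complexify ⟨(Q : Sequence) + t • g, hQ⟩ = ⟨_, hmem⟩ := Subtype.ext hline
  rw [this]

/-- The vector field of `w` is tangent to the reduced potentials. -/
def IsTangent (c ε : ℝ) (w : Model) : Prop :=
  ∀ Q : phaseSpace ε, conjSwap ε (fieldJet c (complexify Q) w).1 = (fieldJet c (complexify Q) w).1

/-- Differentiating in `Q` alone means moving the pair in the direction completed by R = -εQ*.
Tangency says that this completion of the first component is the whole vector field, so the
derivative of the pair system appears. -/
theorem lieProduct_scalarFlow {c : ℝ} {w w' : Model} (hw : IsTangent c ε w)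
    (hw' : IsTangent c ε w') :
    lieProduct (scalarFlow c ε w) (scalarFlow c ε w') = scalarFlow c ε (modelBracket w w') := by
  have key : ∀ (w w' : Model), IsTangent c ε w' → ∀ Q : phaseSpace ε,
      gateaux (scalarFlow c ε w) Q (scalarFlow c ε w' Q) =
        ((fieldJet c (complexify Q) w).2 (fieldJet c (complexify Q) w').1 : VecSequence).1 := by
    intro w w' hw' Q
    have hg : scalarFlow c ε w' Q ∈ rapid := (fieldJet c (complexify Q) w').1.2.1
    have hv : (⟨reduced ε (scalarFlow c ε w' Q), reduced_rapid hg⟩ : rapidVec) =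
        (fieldJet c (complexify Q) w').1 := by
      have h2 := congrArg Prod.snd (hw' Q)
      exact Subtype.ext (Prod.ext rfl h2)
    funext n
    rw [gateaux, (hasDerivAt_alongLine c w Q hg n).deriv, hv]
  funext Q
  rw [lieProduct, key w w' hw', key w' w hw, scalarFlow_apply, ← jetBracket_fieldJet]
  rfl

theorem IsTangent.add {c : ℝ} {w w' : Model} (hw : IsTangent c ε w) (hw' : IsTangent c ε w') :
    IsTangent c ε (w + w') := fun Q => by
  rw [map_add, Prod.fst_add, Submodule.coe_add, conjSwap_add, hw Q, hw' Q]

theorem IsTangent.smul {c : ℝ} {w : Model} (a : ℝ) (hw : IsTangent c ε w) :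
    IsTangent c ε ((a : ℂ) • w) := fun Q => by
  rw [map_smul, Prod.smul_fst, Submodule.coe_smul, conjSwap_smul, hw Q, Complex.conj_ofReal]

end reduction

end

end IDNLS

/-! ### Structure constants, real span and Lie algebra -/

namespace IDNLS

noncomputable section

open LaurentPolynomial ComplexConjugate

/-! ### Brackets of the flows in the model -/

/-- With T = e^x, `polyAKNS` is 2cosh x - 2, `polySeed 1` is sinh x and `euler` is d/dx. This and
the next two identities are the rules for cosh and sinh, and all structure constants follow from
them. -/
theorem euler_polyAKNS : euler polyAKNS = (2 : ℂ) • polySeed 1 := by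
  simp only [polyAKNS, polySeed, one_ne_zero, if_false, map_add, map_sub, Derivation.map_smul,
    Derivation.map_one_eq_zero, euler_T]
  push_cast
  module

theorem euler_polySeed_one : euler (polySeed 1) = (1 / 2 : ℂ) • polyAKNS + 1 := by
  simp only [polyAKNS, polySeed, one_ne_zero, if_false, map_sub, Derivation.map_smul, euler_T]
  push_cast
  module

theorem polySeed_one_mul_self :
    polySeed 1 * polySeed 1 = (1 / 4 : ℂ) • (polyAKNS ^ 2 + (4 : ℂ) • polyAKNS) := by
  have h : (T (-1) : ℂ[T;T⁻¹]) * T 1 = 1 := by rw [← T_add]; rfl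
  simp only [polyAKNS, polySeed, one_ne_zero, if_false, Algebra.smul_def]
  have h2 : algebraMap ℂ ℂ[T;T⁻¹] (1 / 2) * algebraMap ℂ ℂ[T;T⁻¹] (1 / 2) =
    algebraMap ℂ ℂ[T;T⁻¹] (1 / 4) := by rw [← map_mul]; norm_num
  simp only [map_ofNat]
  linear_combination (T 1 - T (-1)) ^ 2 * h2 - 4 * algebraMap ℂ ℂ[T;T⁻¹] (1 / 4) * h

theorem polySeed_zero : polySeed 0 = 1 := rfl

/-- The Laurent polynomials of `K^{(l-1)}_{[1]}`, with the convention `K^{(-1)}_{[1]} = 0`. -/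
def polyPred : ℕ → ℂ[T;T⁻¹]
  | 0 => 0
  | l + 1 => polyAKNS ^ l * polySeed 1

/-- If m + s = 0 then m = 0, and the convention that `polyPred 0` is zero agrees with the vanishing
coefficient. -/
theorem euler_pow_mul_pow (m s : ℕ) :
    euler (polyAKNS ^ m) * polyAKNS ^ s = (2 * (m : ℂ)) • polyPred (m + s) := by
  rcases m with _ | k
  · simp
  · rw [Derivation.leibniz_pow, euler_polyAKNS, add_right_comm, polyPred, Nat.add_sub_cancel,
      smul_eq_mul, pow_add]
    algebra

theorem euler_pow_mul_seed (m s : ℕ) :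
    euler (polyAKNS ^ m) * (polyAKNS ^ s * polySeed 1) =
      (1 / 2 * (m : ℂ)) • (polyAKNS ^ (m + s + 1) + (4 : ℂ) • polyAKNS ^ (m + s)) := by
  rcases m with _ | k
  · simp
  · rw [Derivation.leibniz_pow, euler_polyAKNS, Nat.add_sub_cancel, smul_eq_mul, smul_mul_assoc,
      mul_assoc, smul_mul_assoc, mul_left_comm (polySeed 1), polySeed_one_mul_self]
    algebra

theorem euler_seed_mul (j : Fin 2) (m s : ℕ) :
    euler (polyAKNS ^ m * polySeed 1) * (polyAKNS ^ s * polySeed j) =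
      (1 / 2 : ℂ) • (((m : ℂ) + 1) • (polyAKNS ^ (m + s + 1) * polySeed j) +
        (2 * (2 * (m : ℂ) + 1)) • (polyAKNS ^ (m + s) * polySeed j)) := by
  have h : euler (polyAKNS ^ m * polySeed 1) = polyAKNS ^ m * ((1 / 2 : ℂ) • polyAKNS + 1) +
      (1 / 2 * (m : ℂ)) • (polyAKNS ^ (m + 1) + (4 : ℂ) • polyAKNS ^ m) := by
    have := euler_pow_mul_seed m 0
    rw [pow_zero, one_mul, add_zero] at this
    rw [Derivation.leibniz, smul_eq_mul, smul_eq_mul, euler_polySeed_one, ← this, mul_comm]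
    ring
  rw [h]
  algebra

theorem scalarFlow_pred_iso (c ε : ℝ) (l : ℕ) :
    scalarFlow c ε (polyPred l, 0) = pred (isoFlow c ε 1) l := by
  rcases l with _ | l
  · exact map_zero _
  · exact scalarFlow_modelIso c 1 l

theorem scalarFlow_pred_noniso (c ε : ℝ) (l : ℕ) :
    scalarFlow c ε (0, polyPred l) = pred (nonisoFlow c ε 1) l := by
  rcases l with _ | l
  · exact map_zero _
  · exact scalarFlow_modelNoniso c 1 l

/-! ### The real span -/

theorem phase_zero : phase 0 = -Complex.I := by simp [phase]

theorem phase_one : phase 1 = 1 := by simp [phase]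

/-- The real span of the Laurent polynomials of the flows, with their phases. -/
def realPoly : Submodule ℝ ℂ[T;T⁻¹] :=
  Submodule.span ℝ {p | ∃ (j : Fin 2) (m : ℕ), p = phase j • (polyAKNS ^ m * polySeed j)}

theorem phase_smul_mem (j : Fin 2) (m : ℕ) : phase j • (polyAKNS ^ m * polySeed j) ∈ realPoly :=
  Submodule.subset_span ⟨j, m, rfl⟩

theorem real_smul_mem (a : ℝ) {p : ℂ[T;T⁻¹]} (hp : p ∈ realPoly) : (a : ℂ) • p ∈ realPoly := by
  have := realPoly.smul_mem a hp
  rwa [← Complex.coe_smul] at this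

theorem polyPred_mem (l : ℕ) : polyPred l ∈ realPoly := by
  rcases l with _ | l
  · exact realPoly.zero_mem
  · have := phase_smul_mem 1 l
    rwa [phase_one, one_smul] at this

theorem pow_mem (m : ℕ) : Complex.I • polyAKNS ^ m ∈ realPoly := by
  have := realPoly.neg_mem (phase_smul_mem 0 m)
  rwa [phase_zero, polySeed_zero, mul_one, neg_smul, neg_neg] at this

/-- Elements of `realPoly` change sign under T ↦ T⁻¹ combined with conjugation of the coefficients:
the symmetric part is imaginary, the antisymmetric part real. The Euler derivation reverses this
sign, so the product again changes sign. On generators the real coefficients are explicit. -/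
theorem euler_mul_mem {p q : ℂ[T;T⁻¹]} (hp : p ∈ realPoly) (hq : q ∈ realPoly) :
    euler p * q ∈ realPoly := by
  induction hp using Submodule.span_induction with
  | zero => simp
  | add p p' _ _ hp hp' => rw [map_add, add_mul]; exact realPoly.add_mem hp hp'
  | smul a p _ hp =>
    rw [← Complex.coe_smul, Derivation.map_smul, smul_mul_assoc]
    exact real_smul_mem a hp
  | mem p hp =>
    obtain ⟨j, m, rfl⟩ := hp
    induction hq using Submodule.span_induction with
    | zero => simp
    | add q q' _ _ hq hq' => rw [mul_add]; exact realPoly.add_mem hq hq'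
    | smul a q _ hq =>
      rw [← Complex.coe_smul, mul_smul_comm]
      exact real_smul_mem a hq
    | mem q hq =>
      obtain ⟨k, s, rfl⟩ := hq
      rw [Derivation.map_smul, smul_mul_assoc, mul_smul_comm, smul_smul]
      fin_cases j
      · simp only [Fin.zero_eta, polySeed_zero, phase_zero, mul_one]
        fin_cases k
        · simp only [Fin.zero_eta, polySeed_zero, phase_zero, mul_one, euler_pow_mul_pow]
          convert real_smul_mem (-(2 * m)) (polyPred_mem (m + s)) using 1
          rw [smul_smul]
          congr 1
          push_cast
          linear_combination (2 * (m : ℂ)) * Complex.I_mul_I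
        · simp only [Fin.mk_one, phase_one, euler_pow_mul_seed]
          convert real_smul_mem (-(1 / 2 * m)) (realPoly.add_mem (pow_mem (m + s + 1))
            (real_smul_mem 4 (pow_mem (m + s)))) using 1
          push_cast
          module
      · simp only [Fin.mk_one, phase_one, one_mul, euler_seed_mul]
        convert realPoly.add_mem (real_smul_mem (1 / 2 * (m + 1)) (phase_smul_mem k (m + s + 1)))
          (real_smul_mem (2 * m + 1) (phase_smul_mem k (m + s))) using 1
        push_cast
        module

theorem modelBracket_mem {w w' : Model} (hw : w ∈ realPoly.prod realPoly)
    (hw' : w' ∈ realPoly.prod realPoly) : modelBracket w w' ∈ realPoly.prod realPoly :=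
  ⟨realPoly.sub_mem (euler_mul_mem hw.1 hw'.2) (euler_mul_mem hw'.1 hw.2),
    realPoly.sub_mem (euler_mul_mem hw.2 hw'.2) (euler_mul_mem hw'.2 hw.2)⟩

theorem modelBracket_iso_iso (a b : ℂ) (p q : ℂ[T;T⁻¹]) :
    modelBracket (a • (p, 0)) (b • (q, 0)) = 0 := by
  simp [modelBracket]

theorem modelBracket_iso_noniso (a b : ℂ) (p q : ℂ[T;T⁻¹]) :
    modelBracket (a • (p, 0)) (b • (0, q)) = ((a * b) • (euler p * q), 0) := by
  simp [modelBracket, smul_smul, mul_comm]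

theorem modelBracket_noniso_noniso (a b : ℂ) (p q : ℂ[T;T⁻¹]) :
    modelBracket (a • (0, p)) (b • (0, q)) = (0, (a * b) • (euler p * q - euler q * p)) := by
  simp [modelBracket, smul_smul, smul_sub, mul_comm]

section reduction

variable {c ε : ℝ}

/-- The basic seed changes sign under the involution, which the factor -i repairs by antilinearity.
The seed with L - L⁻¹ receives a second sign, so the factor 1 is right there. -/
theorem conjSwap_seed {u v : VecSequence} (hu : conjSwap ε u = u)
    (hv : conjSwap ε v = (-1 : ℂ) • v) (j : Fin 2) (m : ℕ) :
    conjSwap ε (phase j • (recursionAKNS c u)^[m]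
      (if j = 0 then v else (1 / 2 : ℂ) • (recursionL c u v - recursionLInv c u v))) =
      phase j • (recursionAKNS c u)^[m]
        (if j = 0 then v else (1 / 2 : ℂ) • (recursionL c u v - recursionLInv c u v)) := by
  rw [conjSwap_smul, conjSwap_iterate_recursionAKNS hu]
  fin_cases j
  · simp only [Fin.zero_eta, if_true, phase_zero, hv, iterate_recursionAKNS_smul, smul_smul]
    simp
  · simp only [Fin.mk_one, one_ne_zero, if_false, phase_one, map_one, conjSwap_smul, conjSwap_sub,
      ← recursionLInv_conjSwap hu, ← recursionL_conjSwap hu, hv, recursionL_smul,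
      recursionLInv_smul, map_div₀, Complex.conj_ofNat]
    congr 2
    module

theorem conjSwap_affine (hε : ε = 1 ∨ ε = -1) (Q : Sequence) {κ a : ℂ} (hκ : conj κ = κ)
    (ha : conj a = a) :
    conjSwap ε ((fun n => (κ * n + a) * (reduced ε Q).1 n),
      fun n => -((κ * n + a) * (reduced ε Q).2 n)) =
      (-1 : ℂ) • ((fun n => (κ * n + a) * (reduced ε Q).1 n),
        fun n => -((κ * n + a) * (reduced ε Q).2 n)) := by
  have hr := conjSwap_reduced hε Q
  refine Prod.ext (funext fun n => ?_) (funext fun n => ?_)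
  · have := congrFun (congrArg Prod.fst hr) n
    simp only [conjSwap, map_neg, map_mul, map_add, hκ, ha, map_intCast, Prod.smul_fst,
      Pi.smul_apply, smul_eq_mul] at this ⊢
    linear_combination (-(κ * n + a)) * this
  · have := congrFun (congrArg Prod.snd hr) n
    simp only [conjSwap, map_mul, map_add, hκ, ha, map_intCast, Prod.smul_snd,
      Pi.smul_apply, smul_eq_mul] at this ⊢
    linear_combination (κ * n + a) * this

theorem isTangent_modelIso (hε : ε = 1 ∨ ε = -1) (j : Fin 2) (m : ℕ) :
    IsTangent c ε (phase j • modelIso j m) := fun Q => by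
  have h := conjSwap_affine hε Q (κ := 0) (a := 1) (map_zero _) (map_one _)
  have h2 := conjSwap_seed (c := c) (conjSwap_reduced hε Q) h j m
  rw [map_smul, Prod.smul_fst, Submodule.coe_smul, fieldJet_modelIso]
  simp only [zero_mul, zero_add, one_mul] at h2
  exact h2

theorem isTangent_modelNoniso (hε : ε = 1 ∨ ε = -1) (j : Fin 2) (s : ℕ) :
    IsTangent c ε (phase j • modelNoniso j s) := fun Q => by
  have h := conjSwap_affine hε Q (κ := 2) (a := 1) (Complex.conj_ofNat 2) (map_one _)
  have h1 : conjSwap ε ((1 / 2 : ℂ) • ((fun n : ℤ => (2 * (n : ℂ) + 1) * (reduced ε Q).1 n),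
      fun n : ℤ => -((2 * (n : ℂ) + 1) * (reduced ε Q).2 n))) = (-1 : ℂ) • (1 / 2 : ℂ) •
        ((fun n => (2 * n + 1) * (reduced ε Q).1 n), fun n => -((2 * n + 1) * (reduced ε Q).2 n)) := by
    rw [conjSwap_smul, h, map_div₀, map_one, Complex.conj_ofNat, smul_comm]
  have h2 := conjSwap_seed (c := c) (conjSwap_reduced hε Q) h1 j s
  -- The factor 1/4 in the definition of the seed splits as 1/2 · 1/2, one half being moved inside
  -- by linearity.
  have h3 : nonisoSeed c j (reduced ε Q) = if j = 0 then (1 / 2 : ℂ) •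
      ((fun n : ℤ => (2 * (n : ℂ) + 1) * (reduced ε Q).1 n),
        fun n : ℤ => -((2 * (n : ℂ) + 1) * (reduced ε Q).2 n)) else
      (1 / 2 : ℂ) • (recursionL c (reduced ε Q) ((1 / 2 : ℂ) •
        ((fun n : ℤ => (2 * (n : ℂ) + 1) * (reduced ε Q).1 n),
          fun n : ℤ => -((2 * (n : ℂ) + 1) * (reduced ε Q).2 n))) -
        recursionLInv c (reduced ε Q) ((1 / 2 : ℂ) •
          ((fun n : ℤ => (2 * (n : ℂ) + 1) * (reduced ε Q).1 n),
            fun n : ℤ => -((2 * (n : ℂ) + 1) * (reduced ε Q).2 n)))) := by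
    simp only [nonisoSeed, recursionL_smul, recursionLInv_smul, ← smul_sub, smul_smul]
    norm_num
  rw [map_smul, Prod.smul_fst, Submodule.coe_smul, fieldJet_modelNoniso]
  change conjSwap ε (phase j • (recursionAKNS c (reduced ε Q))^[s] (nonisoSeed c j (reduced ε Q))) =
    phase j • (recursionAKNS c (reduced ε Q))^[s] (nonisoSeed c j (reduced ε Q))
  rw [h3]
  exact h2

/-- Membership in the real model is decided on generators, for the isospectral and the
non-isospectral component. -/
theorem realModel_induction {motive : Model → Prop} {w : Model} (hw : w ∈ realPoly.prod realPoly)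
    (iso : ∀ j m, motive (phase j • modelIso j m))
    (noniso : ∀ j s, motive (phase j • modelNoniso j s)) (zero : motive 0)
    (add : ∀ w w', motive w → motive w' → motive (w + w'))
    (smul : ∀ (a : ℝ) (w), motive w → motive ((a : ℂ) • w)) : motive w := by
  obtain ⟨p, q⟩ := w
  obtain ⟨hwp, hwq⟩ : p ∈ realPoly ∧ q ∈ realPoly := hw
  have hp : motive (p, 0) := by
    induction hwp using Submodule.span_induction with
    | zero => exact zero
    | add p p' _ _ h h' => simpa using add _ _ h h'
    | smul a p _ h => simpa [← Complex.coe_smul] using smul a _ h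
    | mem p h =>
      obtain ⟨j, m, rfl⟩ := h
      simpa [modelIso] using iso j m
  have hq : motive (0, q) := by
    induction hwq using Submodule.span_induction with
    | zero => exact zero
    | add p p' _ _ h h' => simpa using add _ _ h h'
    | smul a p _ h => simpa [← Complex.coe_smul] using smul a _ h
    | mem p h =>
      obtain ⟨j, m, rfl⟩ := h
      simpa [modelNoniso] using noniso j m
  simpa using add _ _ hp hq

theorem isTangent_of_mem (hε : ε = 1 ∨ ε = -1) {w : Model} (hw : w ∈ realPoly.prod realPoly) :
    IsTangent c ε w := by
  refine realModel_induction hw (isTangent_modelIso hε) (isTangent_modelNoniso hε) (fun Q => ?_)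
    (fun _ _ => IsTangent.add) (fun a _ => IsTangent.smul a)
  rw [map_zero]
  exact Prod.ext (funext fun n => by simp [conjSwap]) (funext fun n => by simp [conjSwap])

theorem scalarFlow_mem {w : Model} (hw : w ∈ realPoly.prod realPoly) :
    scalarFlow c ε w ∈ flowSpan c ε := by
  refine realModel_induction (motive := fun w => scalarFlow c ε w ∈ flowSpan c ε) hw
    (fun j m => ?_) (fun j s => ?_) ?_ (fun w w' h h' => ?_)
    (fun a w h => ?_)
  · rw [map_smul, scalarFlow_modelIso]
    exact Submodule.subset_span (Or.inl ⟨j, m, rfl⟩)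
  · rw [map_smul, scalarFlow_modelNoniso]
    exact Submodule.subset_span (Or.inr ⟨j, s, rfl⟩)
  · rw [map_zero]
    exact Submodule.zero_mem _
  · rw [map_add]
    exact Submodule.add_mem _ h h'
  · rw [map_smul, Complex.coe_smul]
    exact Submodule.smul_mem _ a h

theorem modelIso_mem (j : Fin 2) (m : ℕ) : phase j • modelIso j m ∈ realPoly.prod realPoly :=
  ⟨phase_smul_mem j m, by simp [modelIso]⟩

theorem modelNoniso_mem (j : Fin 2) (s : ℕ) :
    phase j • modelNoniso j s ∈ realPoly.prod realPoly :=
  ⟨by simp [modelNoniso], phase_smul_mem j s⟩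

/-- Only surjectivity of the model onto the span is needed: the Lie product is defined on the flows
themselves, so it does not depend on the representative. -/
theorem exists_of_mem_flowSpan {f : ScalarFlow ε} (hf : f ∈ flowSpan c ε) :
    ∃ w ∈ realPoly.prod realPoly, scalarFlow c ε w = f := by
  induction hf using Submodule.span_induction with
  | zero => exact ⟨0, Submodule.zero_mem _, map_zero _⟩
  | add f g _ _ hf hg =>
    obtain ⟨w, hw, rfl⟩ := hf
    obtain ⟨w', hw', rfl⟩ := hg
    exact ⟨w + w', Submodule.add_mem _ hw hw', map_add _ _ _⟩
  | smul a f _ hf =>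
    obtain ⟨w, hw, rfl⟩ := hf
    refine ⟨a • w, Submodule.smul_mem _ a hw, ?_⟩
    rw [← Complex.coe_smul, map_smul, Complex.coe_smul]
  | mem f h =>
    rcases h with ⟨j, m, rfl⟩ | ⟨j, s, rfl⟩
    · exact ⟨_, modelIso_mem j m, by rw [map_smul, scalarFlow_modelIso]⟩
    · exact ⟨_, modelNoniso_mem j s, by rw [map_smul, scalarFlow_modelNoniso]⟩

theorem lieProduct_of_mem (hε : ε = 1 ∨ ε = -1) {w w' : Model} (hw : w ∈ realPoly.prod realPoly)
    (hw' : w' ∈ realPoly.prod realPoly) :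
    lieProduct (scalarFlow c ε w) (scalarFlow c ε w') = scalarFlow c ε (modelBracket w w') :=
  lieProduct_scalarFlow (isTangent_of_mem hε hw) (isTangent_of_mem hε hw')

theorem lieProduct_self (f : ScalarFlow ε) : lieProduct f f = 0 := funext fun _ => sub_self _

theorem lieProduct_swap (f g : ScalarFlow ε) : lieProduct f g = -lieProduct g f :=
  funext fun _ => (neg_sub _ _).symm

theorem lieProduct_mem (hε : ε = 1 ∨ ε = -1) {f g : ScalarFlow ε} (hf : f ∈ flowSpan c ε)
    (hg : g ∈ flowSpan c ε) : lieProduct f g ∈ flowSpan c ε := by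
  obtain ⟨w, hw, rfl⟩ := exists_of_mem_flowSpan hf
  obtain ⟨w', hw', rfl⟩ := exists_of_mem_flowSpan hg
  rw [lieProduct_of_mem hε hw hw']
  exact scalarFlow_mem (modelBracket_mem hw hw')

/-- Additivity is not formal for `lieProduct`, since it involves both differentiability of the flows
and linearity of the derivative in its direction. The model supplies both. -/
theorem lieProduct_add_left (hε : ε = 1 ∨ ε = -1) {f f' g : ScalarFlow ε} (hf : f ∈ flowSpan c ε)
    (hf' : f' ∈ flowSpan c ε) (hg : g ∈ flowSpan c ε) :
    lieProduct (f + f') g = lieProduct f g + lieProduct f' g := by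
  obtain ⟨w, hw, rfl⟩ := exists_of_mem_flowSpan hf
  obtain ⟨w', hw', rfl⟩ := exists_of_mem_flowSpan hf'
  obtain ⟨x, hx, rfl⟩ := exists_of_mem_flowSpan hg
  rw [← map_add, lieProduct_of_mem hε (Submodule.add_mem _ hw hw') hx, lieProduct_of_mem hε hw hx,
    lieProduct_of_mem hε hw' hx, modelBracket_add_left, map_add]

theorem lieProduct_smul_left (hε : ε = 1 ∨ ε = -1) (a : ℝ) {f g : ScalarFlow ε}
    (hf : f ∈ flowSpan c ε) (hg : g ∈ flowSpan c ε) :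
    lieProduct (a • f) g = a • lieProduct f g := by
  obtain ⟨w, hw, rfl⟩ := exists_of_mem_flowSpan hf
  obtain ⟨x, hx, rfl⟩ := exists_of_mem_flowSpan hg
  have haw : (a : ℂ) • w ∈ realPoly.prod realPoly := by
    rw [Complex.coe_smul]
    exact Submodule.smul_mem _ a hw
  rw [← Complex.coe_smul, ← map_smul, lieProduct_of_mem hε haw hx, lieProduct_of_mem hε hw hx,
    modelBracket_smul_left, map_smul, Complex.coe_smul]

/-- The Lie product on the span of the flows. -/
def flowBracket (c : ℝ) {ε : ℝ} (hε : ε = 1 ∨ ε = -1) :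
    flowSpan c ε →ₗ[ℝ] flowSpan c ε →ₗ[ℝ] flowSpan c ε :=
  LinearMap.mk₂ ℝ (fun f g => ⟨lieProduct f g, lieProduct_mem hε f.2 g.2⟩)
    (fun f f' g => Subtype.ext (lieProduct_add_left hε f.2 f'.2 g.2))
    (fun a f g => Subtype.ext (lieProduct_smul_left hε a f.2 g.2))
    (fun f g g' => Subtype.ext <| by
      change lieProduct (f : ScalarFlow ε) (g + g' : ScalarFlow ε) =
        lieProduct (f : ScalarFlow ε) g + lieProduct (f : ScalarFlow ε) g'
      rw [lieProduct_swap, lieProduct_add_left hε g.2 g'.2 f.2, neg_add, ← lieProduct_swap,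
        ← lieProduct_swap])
    (fun a f g => Subtype.ext <| by
      change lieProduct (f : ScalarFlow ε) (a • g : ScalarFlow ε) =
        a • lieProduct (f : ScalarFlow ε) g
      rw [lieProduct_swap, lieProduct_smul_left hε a g.2 f.2, ← smul_neg, ← lieProduct_swap])

theorem coe_flowBracket (hε : ε = 1 ∨ ε = -1) (f g : flowSpan c ε) :
    (flowBracket c hε f g : ScalarFlow ε) = lieProduct (f : ScalarFlow ε) g := rfl

theorem flowBracket_jacobi (hε : ε = 1 ∨ ε = -1) (f g h : flowSpan c ε) :
    flowBracket c hε f (flowBracket c hε g h) + flowBracket c hε g (flowBracket c hε h f) +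
      flowBracket c hε h (flowBracket c hε f g) = 0 := by
  refine Subtype.ext ?_
  obtain ⟨_, hf⟩ := f
  obtain ⟨_, hg⟩ := g
  obtain ⟨_, hh⟩ := h
  obtain ⟨x, hx, rfl⟩ := exists_of_mem_flowSpan hf
  obtain ⟨y, hy, rfl⟩ := exists_of_mem_flowSpan hg
  obtain ⟨z, hz, rfl⟩ := exists_of_mem_flowSpan hh
  simp only [Submodule.coe_add, coe_flowBracket]
  rw [lieProduct_of_mem hε hy hz, lieProduct_of_mem hε hz hx, lieProduct_of_mem hε hx hy,
    lieProduct_of_mem hε hx (modelBracket_mem hy hz),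
    lieProduct_of_mem hε hy (modelBracket_mem hz hx),
    lieProduct_of_mem hε hz (modelBracket_mem hx hy), ← map_add, ← map_add, modelBracket_jacobi,
    map_zero]
  rfl

end reduction

end

end IDNLS

/-! ### The theorem, by translation to the model -/

theorem mainTheorem2 (c ε : ℝ) (hε : ε = 1 ∨ ε = -1) :
    -- the flows in the span are rapidly decreasing and Gateaux differentiable
    (∀ f ∈ IDNLS.flowSpan c ε, ∀ Q : IDNLS.phaseSpace ε,
      IDNLS.RapidlyDecreasing (f Q) ∧
      ∀ g : IDNLS.Sequence, IDNLS.RapidlyDecreasing g →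
        ∀ n : ℤ, DifferentiableAt ℝ (IDNLS.alongLine f Q g n) 0) ∧
    -- the span is a real Lie algebra under the Lie product
    (∃ B : IDNLS.flowSpan c ε →ₗ[ℝ] IDNLS.flowSpan c ε →ₗ[ℝ] IDNLS.flowSpan c ε,
      (∀ f g, (B f g : IDNLS.ScalarFlow ε) = IDNLS.lieProduct (f : IDNLS.ScalarFlow ε) g) ∧
      (∀ f, B f f = 0) ∧
      (∀ f g h, B f (B g h) + B g (B h f) + B h (B f g) = 0)) ∧
    -- the structure relations
    (∀ (j k : Fin 2) (m s : ℕ),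
      IDNLS.lieProduct (IDNLS.phase j • IDNLS.isoFlow c ε j m)
        (IDNLS.phase k • IDNLS.isoFlow c ε k s) = 0) ∧
    (∀ m s : ℕ,
      IDNLS.lieProduct (-Complex.I • IDNLS.isoFlow c ε 0 m)
        (-Complex.I • IDNLS.nonisoFlow c ε 0 s) =
      (-2 * (m : ℂ)) • IDNLS.pred (IDNLS.isoFlow c ε 1) (m + s)) ∧
    (∀ m s : ℕ,
      IDNLS.lieProduct (-Complex.I • IDNLS.isoFlow c ε 0 m) (IDNLS.nonisoFlow c ε 1 s) =
      (-(1 / 2) * Complex.I * (m : ℂ)) •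
        (IDNLS.isoFlow c ε 0 (m + s + 1) + (4 : ℂ) • IDNLS.isoFlow c ε 0 (m + s))) ∧
    (∀ (j : Fin 2) (m s : ℕ),
      IDNLS.lieProduct (IDNLS.isoFlow c ε 1 m) (IDNLS.phase j • IDNLS.nonisoFlow c ε j s) =
      ((1 / 2) * IDNLS.phase j) •
        (((m : ℂ) + 1) • IDNLS.isoFlow c ε j (m + s + 1) +
          (2 * (2 * (m : ℂ) + 1)) • IDNLS.isoFlow c ε j (m + s))) ∧
    (∀ m s : ℕ,
      IDNLS.lieProduct (-Complex.I • IDNLS.nonisoFlow c ε 0 m)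
        (-Complex.I • IDNLS.nonisoFlow c ε 0 s) =
      (-2 * ((m : ℂ) - s)) • IDNLS.pred (IDNLS.nonisoFlow c ε 1) (m + s)) ∧
    (∀ (j : Fin 2) (m s : ℕ),
      IDNLS.lieProduct (IDNLS.phase j • IDNLS.nonisoFlow c ε j m) (IDNLS.nonisoFlow c ε 1 s) =
      ((1 / 2) * IDNLS.phase j) •
        (((m : ℂ) - s - 1 + ((j : ℕ) : ℂ)) • IDNLS.nonisoFlow c ε j (m + s + 1) +
          (2 * (2 * (m : ℂ) - 2 * s - 1 + ((j : ℕ) : ℂ))) • IDNLS.nonisoFlow c ε j (m + s))) := by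
  open IDNLS in
  refine ⟨fun f hf Q => ?_, ⟨flowBracket c hε, fun f g => rfl, fun f => ?_,
    flowBracket_jacobi hε⟩, fun j k m s => ?_, fun m s => ?_, fun m s => ?_, fun j m s => ?_,
    fun m s => ?_, fun j m s => ?_⟩
  · obtain ⟨w, -, rfl⟩ := exists_of_mem_flowSpan hf
    exact ⟨(fieldJet c (complexify Q) w).1.2.1,
      fun g hg n => (hasDerivAt_alongLine c w Q hg n).differentiableAt⟩
  · exact Subtype.ext (lieProduct_self _)
  · rw [← scalarFlow_modelIso, ← scalarFlow_modelIso, ← map_smul, ← map_smul,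
      lieProduct_of_mem hε (modelIso_mem j m) (modelIso_mem k s), modelIso, modelIso,
      modelBracket_iso_iso, map_zero]
  · rw [← phase_zero, ← scalarFlow_modelIso, ← scalarFlow_modelNoniso, ← map_smul, ← map_smul,
      lieProduct_of_mem hε (modelIso_mem 0 m) (modelNoniso_mem 0 s), ← scalarFlow_pred_iso,
      ← map_smul, modelIso, modelNoniso, modelBracket_iso_noniso, polySeed_zero, mul_one, mul_one,
      euler_pow_mul_pow, Prod.smul_mk, smul_zero, smul_smul, phase_zero]
    congr 3
    -- The minus sign in the structure constant is (-i)² = -1.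
    linear_combination (2 * (m : ℂ)) * Complex.I_mul_I
  -- A factor `phase 1 = 1` is inserted so that both arguments are phased generators, for which
  -- tangency is known.
  · rw [← phase_zero, ← one_smul ℂ (nonisoFlow c ε 1 s), ← phase_one, ← scalarFlow_modelIso,
      ← scalarFlow_modelIso, ← scalarFlow_modelIso, ← scalarFlow_modelNoniso, ← map_smul,
      ← map_smul, lieProduct_of_mem hε (modelIso_mem 0 m) (modelNoniso_mem 1 s), ← map_smul,
      ← map_add, ← map_smul]
    simp only [modelIso, modelNoniso]
    rw [modelBracket_iso_noniso]
    simp only [polySeed_zero, mul_one, euler_pow_mul_seed, phase_zero, phase_one, Prod.smul_mk, Prod.mk_add_mk, smul_zero, add_zero,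
      smul_smul]
    congr 3
    ring
  · rw [← one_smul ℂ (isoFlow c ε 1 m), ← phase_one, ← scalarFlow_modelIso,
      ← scalarFlow_modelIso, ← scalarFlow_modelIso, ← scalarFlow_modelNoniso, ← map_smul,
      ← map_smul, lieProduct_of_mem hε (modelIso_mem 1 m) (modelNoniso_mem j s), ← map_smul,
      ← map_smul, ← map_add, ← map_smul]
    simp only [modelIso, modelNoniso]
    rw [modelBracket_iso_noniso]
    simp only [euler_seed_mul, phase_one,
      Prod.smul_mk, Prod.mk_add_mk, smul_zero, add_zero, smul_smul]
    congr 3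
    ring
  · rw [← phase_zero, ← scalarFlow_modelNoniso, ← scalarFlow_modelNoniso, ← map_smul, ← map_smul,
      lieProduct_of_mem hε (modelNoniso_mem 0 m) (modelNoniso_mem 0 s), ← scalarFlow_pred_noniso,
      ← map_smul, modelNoniso, modelNoniso, modelBracket_noniso_noniso, polySeed_zero, mul_one,
      mul_one, euler_pow_mul_pow, euler_pow_mul_pow, add_comm s m, ← sub_smul, Prod.smul_mk,
      smul_zero, smul_smul, phase_zero]
    congr 3
    linear_combination (2 * (m : ℂ) - 2 * s) * Complex.I_mul_I
  · rw [← one_smul ℂ (nonisoFlow c ε 1 s), ← phase_one, ← scalarFlow_modelNoniso,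
      ← scalarFlow_modelNoniso, ← scalarFlow_modelNoniso, ← scalarFlow_modelNoniso, ← map_smul,
      ← map_smul, lieProduct_of_mem hε (modelNoniso_mem j m) (modelNoniso_mem 1 s), ← map_smul,
      ← map_smul, ← map_add, ← map_smul]
    simp only [modelNoniso]
    rw [modelBracket_noniso_noniso]
    simp only [euler_seed_mul, phase_one, Prod.smul_mk, Prod.mk_add_mk, smul_zero, add_zero]
    congr 2
    fin_cases j
    · simp only [Fin.zero_eta, polySeed_zero, mul_one, euler_pow_mul_seed, add_comm s m]
      push_cast
      module
    · simp only [Fin.mk_one, euler_seed_mul, add_comm s m]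
      push_cast
      module
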